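/- Let $N\ge 2$ and let $\Omega\subset\mathbb R^N$ be a bounded domain (nonempty, open, connected) with Lipschitz boundary. Let $\mathscr C$ be the set of all continuous $p:\overline\Omega\to\mathbb R$ such that $1<\inf_\Omega p\le\sup_\Omega p<N$ and such that, for some $L>0$, $$|p(x)-p(y)|\le-\frac{L}{\log|x-y|}\qquad\text{for all }x,y\in\Omega\text{ with }0<|x-y|\le\tfrac12 .$$ For $p\in\mathscr C$ let $\varrho_{p(x)}(f)=\int_\Omega|f(x)|^{p(x)}\,dx$. The space $L^{p(x)}(\Omega)$ consists of the measurable $f$ with $\varrho_{p(x)}(f)<\infty$, and has the Luxemburg norm $\|f\|_{p(x)}=\inf\{\gamma>0:\varrho_{p(x)}(f/\gamma)\le1\}$. The space $W^{1,p(x)}(\Omega)$ consists of the $u\in L^{p(x)}(\Omega)$ whose distributional gradient $\nabla u$ is in $L^{p(x)}(\Omega)$, and $W^{1,p(x)}_0(\Omega)$ is the closure in it of $C^\infty_{\mathrm c}(\Omega)$ for the norm $\|u\|_{p(x)}+\|\nabla u\|_{p(x)}$. Define $\mathscr E_{p(x)}:L^1(\Omega)\to[0,\infty]$ by $$\mathscr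 E_{p(x)}(u)=\begin{cases}\|\nabla u\|_{p(x)}&\text{if }u\in W^{1,p(x)}_0(\Omega),\\+\infty&\text{otherwise.}\end{cases}$$ For functions $f_h:L^1(\Omega)\to[0,\infty]$, $h\in\mathbb N$, and $u\in L^1(\Omega)$ put $$\Big(\Gamma\text{-}\liminf_{h\to\infty}f_h\Big)(u)=\sup_{U}\ \liminf_{h\to\infty}\ \inf_{v\in U}f_h(v),$$ where $U$ ranges over the open neighbourhoods of $u$ in the norm topology of $L^1(\Omega)$. Let $p\in\mathscr C$ and $p_h\in\mathscr C$ for $h\in\mathbb N$ be such that $p(x)\le p_h(x)$ for all $h\in\mathbb N$ and $x\in\Omega$, and $p_h\to p$ uniformly in $\Omega$. Then $$\mathscr E_{p(x)}(u)\le\Big(\Gamma\text{-}\liminf_{h\to\infty}\mathscr E_{p_h(x)}\Big)(u)\qquad\text{for all }u\in L^1(\Omega).$$ -/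

import Mathlib

open MeasureTheory Filter Topology
open scoped ENNReal NNReal ContDiff

noncomputable section

namespace VarExp

variable {N : ℕ}

/-- The boundary of `Ω` is Lipschitz: near each boundary point, `Ω` is the strict epigraph, in some
direction `e`, of a Lipschitz function defined on the hyperplane orthogonal to `e`. -/
def HasLipschitzBoundary (Ω : Set (EuclideanSpace ℝ (Fin N))) : Prop :=
  ∀ x ∈ frontier Ω, ∃ e : EuclideanSpace ℝ (Fin N), ‖e‖ = 1 ∧
    ∃ r : ℝ, 0 < r ∧ ∃ (K : ℝ≥0) (g : (Submodule.span ℝ {e})ᗮ → ℝ), LipschitzWith K g ∧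
      ∀ y ∈ Metric.ball x r,
        (y ∈ Ω ↔ g ((Submodule.span ℝ {e})ᗮ.orthogonalProjectionOnto y) < inner ℝ e y)

/-- The class of admissible variable exponents on `Ω`. The conditions `one_lt_inf` and `sup_lt` say
`1 < inf_Ω p` and `sup_Ω p < N`. -/
structure IsAdmissible (Ω : Set (EuclideanSpace ℝ (Fin N)))
    (p : EuclideanSpace ℝ (Fin N) → ℝ) : Prop where
  continuousOn : ContinuousOn p (closure Ω)
  one_lt_inf : ∃ a : ℝ, 1 < a ∧ ∀ x ∈ Ω, a ≤ p x
  sup_lt : ∃ b : ℝ, b < (N : ℝ) ∧ ∀ x ∈ Ω, p x ≤ b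
  logHolder : ∃ L : ℝ, 0 < L ∧ ∀ x ∈ Ω, ∀ y ∈ Ω, 0 < ‖x - y‖ → ‖x - y‖ ≤ 1 / 2 →
    |p x - p y| ≤ -(L / Real.log ‖x - y‖)

/-- The `p(x)`-modular `∫_Ω |f(x)|^{p(x)} dx`, for scalar or vector-valued `f`. -/
def modular {F : Type*} [NormedAddCommGroup F] (Ω : Set (EuclideanSpace ℝ (Fin N)))
    (p : EuclideanSpace ℝ (Fin N) → ℝ) (f : EuclideanSpace ℝ (Fin N) → F) : ℝ≥0∞ :=
  ∫⁻ x in Ω, ENNReal.ofReal (‖f x‖ ^ p x)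

/-- Membership in the variable exponent Lebesgue space `L^{p(x)}(Ω)`. -/
def MemLpVar {F : Type*} [NormedAddCommGroup F] (Ω : Set (EuclideanSpace ℝ (Fin N)))
    (p : EuclideanSpace ℝ (Fin N) → ℝ) (f : EuclideanSpace ℝ (Fin N) → F) : Prop :=
  AEStronglyMeasurable f (volume.restrict Ω) ∧ modular Ω p f < ⊤

/-- The Luxemburg norm `inf {γ > 0 : ϱ_{p(x)}(f / γ) ≤ 1}`, with value `∞` if there is no such `γ`. -/
def luxNorm {F : Type*} [NormedAddCommGroup F] [NormedSpace ℝ F]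
    (Ω : Set (EuclideanSpace ℝ (Fin N))) (p : EuclideanSpace ℝ (Fin N) → ℝ)
    (f : EuclideanSpace ℝ (Fin N) → F) : ℝ≥0∞ :=
  ⨅ (γ : ℝ) (_ : 0 < γ) (_ : modular Ω p (fun x => γ⁻¹ • f x) ≤ 1), ENNReal.ofReal γ

/-- `φ` is a smooth function with compact support in `Ω`. -/
def IsTestFunction (Ω : Set (EuclideanSpace ℝ (Fin N)))
    (φ : EuclideanSpace ℝ (Fin N) → ℝ) : Prop :=
  ContDiff ℝ ∞ φ ∧ HasCompactSupport φ ∧ tsupport φ ⊆ Ω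

/-- `G` is a distributional gradient of `u` on `Ω`. -/
def HasWeakGradient (Ω : Set (EuclideanSpace ℝ (Fin N))) (u : EuclideanSpace ℝ (Fin N) → ℝ)
    (G : EuclideanSpace ℝ (Fin N) → EuclideanSpace ℝ (Fin N)) : Prop :=
  LocallyIntegrableOn u Ω ∧ LocallyIntegrableOn G Ω ∧
    ∀ φ : EuclideanSpace ℝ (Fin N) → ℝ, IsTestFunction Ω φ → ∀ e : EuclideanSpace ℝ (Fin N),
      ∫ x in Ω, u x * fderiv ℝ φ x e = -∫ x in Ω, φ x * inner ℝ (G x) e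

open Classical in
/-- The distributional gradient of `u` on `Ω` (unique up to null sets) where it exists as a locally
integrable field; `0` otherwise. -/
def weakGradient (Ω : Set (EuclideanSpace ℝ (Fin N))) (u : EuclideanSpace ℝ (Fin N) → ℝ) :
    EuclideanSpace ℝ (Fin N) → EuclideanSpace ℝ (Fin N) :=
  if h : ∃ G, HasWeakGradient Ω u G then h.choose else 0

/-- Membership in the variable exponent Sobolev space `W^{1,p(x)}(Ω)`. -/
def MemW1 (Ω : Set (EuclideanSpace ℝ (Fin N))) (p : EuclideanSpace ℝ (Fin N) → ℝ)
    (u : EuclideanSpace ℝ (Fin N) → ℝ) : Prop :=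
  MemLpVar Ω p u ∧ (∃ G, HasWeakGradient Ω u G) ∧ MemLpVar Ω p (weakGradient Ω u)

/-- Membership in `W_0^{1,p(x)}(Ω)`, the closure of the test functions in `W^{1,p(x)}(Ω)` for the
norm `‖u‖_{p(x)} + ‖∇u‖_{p(x)}`. -/
def MemW10 (Ω : Set (EuclideanSpace ℝ (Fin N))) (p : EuclideanSpace ℝ (Fin N) → ℝ)
    (u : EuclideanSpace ℝ (Fin N) → ℝ) : Prop :=
  MemW1 Ω p u ∧ ∀ ε : ℝ≥0∞, 0 < ε → ∃ φ : EuclideanSpace ℝ (Fin N) → ℝ, IsTestFunction Ω φ ∧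
    luxNorm Ω p (fun x => u x - φ x) +
      luxNorm Ω p (fun x => weakGradient Ω u x - gradient φ x) < ε

open Classical in
/-- The functional on `L¹(Ω)` equal to `‖∇u‖_{p(x)}` on `W_0^{1,p(x)}(Ω)` and to `+∞` elsewhere. -/
def energy (Ω : Set (EuclideanSpace ℝ (Fin N))) (p : EuclideanSpace ℝ (Fin N) → ℝ)
    (u : Lp ℝ 1 (volume.restrict Ω)) : ℝ≥0∞ :=
  if MemW10 Ω p u then luxNorm Ω p (weakGradient Ω u) else ⊤

/-- The `Γ`-lower limit of a sequence of functions, at `u`: the supremum over open neighbourhoods `U`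
of `u` of the lower limit of `inf_U f_h`. -/
def gammaLiminf {X Y : Type*} [TopologicalSpace X] [CompleteLinearOrder Y] (f : ℕ → X → Y)
    (u : X) : Y :=
  ⨆ (U : Set X) (_ : IsOpen U) (_ : u ∈ U), liminf (fun h => ⨅ v ∈ U, f h v) atTop

end VarExp

end

/-! Fix a finite `c` above the `Γ`-lower limit at `u`. For small `δ` there are an index `h` with
`p_h` uniformly close to `p` and a `v` close to `u` in `L¹` with energy below `c`. Density replaces
`v` by a test function `φ` with `‖∇φ‖_{p_h} < c`, so the `p_h`-modular of `∇φ / c` is at most `1`.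
Since `p ≤ p_h`, the inequality `s ^ p ≤ s ^ q + (q - p)` (`rpow_le_rpow_add_sub`) bounds its
`p`-modular by `1 + δ`.

It remains to show (`memW10_and_luxNorm_le`) that an `L¹` limit of such test functions lies in
`W_0^{1,p}` with gradient norm at most `c`. Instead of weak compactness and Mazur's lemma, the
approximants are chosen to nearly minimise the modular of the gradient over shrinking `L¹`
neighbourhoods of `u`. These are convex, so midpoints compete, and uniform convexity of the modular
(`exists_modular_uniform_convexity`) makes the gradients Cauchy (`exists_modular_cauchy_seq`).
Fatou's lemma gives the norm bound.

Convergence of the functions themselves in `L^{p(x)}` comes from a Poincaré-type bound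
(`exists_bound_modular_of_gradient`). It is a bootstrap: the localised constant-exponent Sobolev
inequality raises integrability by `1 / N` at each stage, until the level exceeds `sup p`. -/

namespace VarExp

/-! ### Pointwise inequalities for powers of norms -/

section Pointwise

variable {E : Type*} [NormedAddCommGroup E] [NormedSpace ℝ E]

theorem norm_midpoint_le (x y : E) : ‖(1 / 2 : ℝ) • (x + y)‖ ≤ (‖x‖ + ‖y‖) / 2 := by
  rw [norm_smul]
  have := norm_add_le x y
  norm_num
  linarith

theorem midpoint_rpow_le {p s t : ℝ} (hp : 1 ≤ p) (hs : 0 ≤ s) (ht : 0 ≤ t) :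
    ((s + t) / 2) ^ p ≤ (s ^ p + t ^ p) / 2 := by
  have h := (convexOn_rpow hp).2 (Set.mem_Ici.2 hs) (Set.mem_Ici.2 ht)
    (by norm_num : (0 : ℝ) ≤ 1 / 2) (by norm_num : (0 : ℝ) ≤ 1 / 2) (by norm_num)
  simp only [smul_eq_mul] at h
  calc ((s + t) / 2) ^ p = (1 / 2 * s + 1 / 2 * t) ^ p := by congr 1; ring
    _ ≤ 1 / 2 * s ^ p + 1 / 2 * t ^ p := h
    _ = _ := by ring

theorem norm_midpoint_rpow_le {p : ℝ} (hp : 1 ≤ p) (x y : E) :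
    ‖(1 / 2 : ℝ) • (x + y)‖ ^ p ≤ (‖x‖ ^ p + ‖y‖ ^ p) / 2 :=
  (Real.rpow_le_rpow (norm_nonneg _) (norm_midpoint_le x y) (by linarith)).trans
    (midpoint_rpow_le hp (norm_nonneg x) (norm_nonneg y))

/-- Strictness has two sources: strict convexity of the space when the norms agree, and strict
convexity of `t ^ p` when they differ. -/
theorem norm_midpoint_rpow_lt [StrictConvexSpace ℝ E] {p : ℝ} (hp : 1 < p) {x y : E}
    (hxy : x ≠ y) : ‖(1 / 2 : ℝ) • (x + y)‖ ^ p < (‖x‖ ^ p + ‖y‖ ^ p) / 2 := by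
  by_cases h : ‖x‖ = ‖y‖
  · rw [← h, add_self_div_two]
    exact Real.rpow_lt_rpow (norm_nonneg _) ((norm_midpoint_lt_iff h).2 hxy) (by linarith)
  · refine (Real.rpow_le_rpow (norm_nonneg _) (norm_midpoint_le x y) (by linarith)).trans_lt ?_
    have h := (strictConvexOn_rpow hp).2 (Set.mem_Ici.2 (norm_nonneg x))
      (Set.mem_Ici.2 (norm_nonneg y)) h
      (by norm_num : (0 : ℝ) < 1 / 2) (by norm_num : (0 : ℝ) < 1 / 2) (by norm_num)
    simp only [smul_eq_mul] at h
    calc ((‖x‖ + ‖y‖) / 2) ^ p = (1 / 2 * ‖x‖ + 1 / 2 * ‖y‖) ^ p := by congr 1; ring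
      _ < 1 / 2 * ‖x‖ ^ p + 1 / 2 * ‖y‖ ^ p := h
      _ = _ := by ring

/-- Quantitative strict convexity of `‖·‖ ^ p` on pairs normalised by `max ‖x‖ ‖y‖ = 1`. -/
theorem exists_midpoint_gap [StrictConvexSpace ℝ E] [ProperSpace E] {a b ε : ℝ} (ha : 1 < a)
    (hε : 0 < ε) : ∃ d : ℝ, 0 < d ∧ ∀ p ∈ Set.Icc a b, ∀ x y : E, max ‖x‖ ‖y‖ = 1 →
      ε ≤ ‖x - y‖ → ‖(1 / 2 : ℝ) • (x + y)‖ ^ p + d ≤ (‖x‖ ^ p + ‖y‖ ^ p) / 2 := by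
  let K : Set (ℝ × E × E) :=
    (Set.Icc a b ×ˢ (Metric.closedBall 0 1 ×ˢ Metric.closedBall 0 1)) ∩
      {z | max ‖z.2.1‖ ‖z.2.2‖ = 1 ∧ ε ≤ ‖z.2.1 - z.2.2‖}
  have hK : IsCompact K := by
    refine (isCompact_Icc.prod ((isCompact_closedBall _ _).prod
      (isCompact_closedBall _ _))).inter_right (IsClosed.inter ?_ ?_)
    · exact isClosed_eq (f := fun z : ℝ × E × E => max ‖z.2.1‖ ‖z.2.2‖) (by fun_prop)
        continuous_const
    · exact isClosed_le (g := fun z : ℝ × E × E => ‖z.2.1 - z.2.2‖) continuous_const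
        (by fun_prop)
  have hcont : ContinuousOn (fun z : ℝ × E × E =>
      (‖z.2.1‖ ^ z.1 + ‖z.2.2‖ ^ z.1) / 2 - ‖(1 / 2 : ℝ) • (z.2.1 + z.2.2)‖ ^ z.1) K := by
    intro z hz
    -- A positive exponent keeps the power jointly continuous where the base vanishes.
    have hz0 : 0 < z.1 := by linarith [hz.1.1.1]
    refine ContinuousAt.continuousWithinAt ?_
    refine ((ContinuousAt.add ?_ ?_).div_const _).sub ?_
    all_goals exact ContinuousAt.rpow (by fun_prop) (by fun_prop) (Or.inr hz0)
  obtain ⟨d, hd, h⟩ := hK.exists_forall_le' hcont (a := 0) (by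
    rintro ⟨p, x, y⟩ ⟨⟨hp, -⟩, -, hxy⟩
    have hne : x ≠ y := by
      rintro rfl
      simp at hxy
      linarith
    have := norm_midpoint_rpow_lt (lt_of_lt_of_le ha hp.1) hne
    simpa using this)
  refine ⟨d, hd, fun p hp x y hm hxy => ?_⟩
  have := h (p, x, y) ⟨⟨hp, by simpa using hm ▸ le_max_left _ _,
    by simpa using hm ▸ le_max_right _ _⟩, hm, hxy⟩
  simp only at this
  linarith

/-- Uniform convexity of the functions `‖·‖ ^ p`, uniformly for `p` in a compact subset of
`(1, ∞)`. -/
theorem exists_uniform_convexity [StrictConvexSpace ℝ E] [ProperSpace E] {a b ε : ℝ} (ha : 1 < a)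
    (hε : 0 < ε) : ∃ C : ℝ, 0 ≤ C ∧ ∀ p ∈ Set.Icc a b, ∀ x y : E,
      ‖x - y‖ ^ p + C * ‖(1 / 2 : ℝ) • (x + y)‖ ^ p ≤ (ε + C / 2) * (‖x‖ ^ p + ‖y‖ ^ p) := by
  have hε' : 0 < min ε 1 := lt_min hε one_pos
  obtain ⟨d, hd, h⟩ := exists_midpoint_gap (E := E) (b := b) ha hε'
  have hC : 0 ≤ 2 ^ b / d := by positivity
  -- This `C` makes `C * d = 2 ^ b`: when `x` and `y` are far apart relative to `t = max ‖x‖ ‖y‖`,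
  -- the gap pays for the crude bound `‖x - y‖ ^ p ≤ (2 * t) ^ p`. When they are close, `ε`
  -- suffices.
  refine ⟨2 ^ b / d, hC, fun p hp x y => ?_⟩
  have hp1 : 1 < p := lt_of_lt_of_le ha hp.1
  have hx := Real.rpow_nonneg (norm_nonneg x) p
  have hy := Real.rpow_nonneg (norm_nonneg y) p
  set t := max ‖x‖ ‖y‖ with ht
  have ht0 : 0 ≤ t := le_max_of_le_left (norm_nonneg x)
  have htp : t ^ p ≤ ‖x‖ ^ p + ‖y‖ ^ p := by
    rcases max_choice ‖x‖ ‖y‖ with h | h <;> rw [ht, h] <;> linarith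
  have hmid := norm_midpoint_rpow_le hp1.le x y
  rcases le_or_gt ‖x - y‖ (min ε 1 * t) with hc | hc
  · have h1 : ‖x - y‖ ^ p ≤ ε * t ^ p := by
      calc ‖x - y‖ ^ p ≤ (min ε 1 * t) ^ p :=
            Real.rpow_le_rpow (norm_nonneg _) hc (by linarith)
        _ = (min ε 1) ^ p * t ^ p := Real.mul_rpow hε'.le ht0
        _ ≤ ε * t ^ p := by
          gcongr
          calc (min ε 1) ^ p ≤ (min ε 1) ^ (1 : ℝ) :=
                Real.rpow_le_rpow_of_exponent_ge hε' (min_le_right _ _) hp1.le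
            _ ≤ ε := by rw [Real.rpow_one]; exact min_le_left _ _
    have h2 := mul_le_mul_of_nonneg_left hmid hC
    have h3 := mul_le_mul_of_nonneg_left htp hε.le
    nlinarith
  · have htpos : 0 < t := by
      rcases ht0.lt_or_eq with h0 | h0
      · exact h0
      · have hx0 : ‖x‖ ≤ 0 := h0 ▸ le_max_left _ _
        have hy0 : ‖y‖ ≤ 0 := h0 ▸ le_max_right _ _
        rw [norm_le_zero_iff] at hx0 hy0
        rw [← h0, hx0, hy0] at hc
        simp at hc
    have hn : ∀ z : E, ‖t⁻¹ • z‖ = t⁻¹ * ‖z‖ := fun z => by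
      rw [norm_smul, Real.norm_of_nonneg (inv_nonneg.2 ht0)]
    have key := h p hp (t⁻¹ • x) (t⁻¹ • y)
      (by rw [hn, hn, ← mul_max_of_nonneg _ _ (inv_nonneg.2 ht0), ← ht,
        inv_mul_cancel₀ htpos.ne'])
      (by rw [← smul_sub, hn, inv_mul_eq_div, le_div_iff₀ htpos]; exact hc.le)
    rw [← smul_add, smul_comm, hn, hn, hn, Real.mul_rpow (inv_nonneg.2 ht0) (norm_nonneg _),
      Real.mul_rpow (inv_nonneg.2 ht0) (norm_nonneg _),
      Real.mul_rpow (inv_nonneg.2 ht0) (norm_nonneg _), Real.inv_rpow ht0] at key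
    have htp0 : 0 < t ^ p := Real.rpow_pos_of_pos htpos p
    have gap : ‖(1 / 2 : ℝ) • (x + y)‖ ^ p + d * t ^ p ≤ (‖x‖ ^ p + ‖y‖ ^ p) / 2 := by
      have := mul_le_mul_of_nonneg_right key htp0.le
      have e : (t ^ p)⁻¹ * t ^ p = 1 := inv_mul_cancel₀ htp0.ne'
      calc _ = ((t ^ p)⁻¹ * t ^ p) * ‖(1 / 2 : ℝ) • (x + y)‖ ^ p + d * t ^ p := by rw [e, one_mul]
        _ = _ := by ring
        _ ≤ _ := this
        _ = ((t ^ p)⁻¹ * t ^ p) * ((‖x‖ ^ p + ‖y‖ ^ p) / 2) := by ring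
        _ = _ := by rw [e, one_mul]
    have hdiff : ‖x - y‖ ^ p ≤ 2 ^ b * t ^ p := by
      calc ‖x - y‖ ^ p ≤ (2 * t) ^ p := by
            refine Real.rpow_le_rpow (norm_nonneg _) ?_ (by linarith)
            linarith [norm_sub_le x y, le_max_left ‖x‖ ‖y‖, le_max_right ‖x‖ ‖y‖]
        _ = 2 ^ p * t ^ p := Real.mul_rpow (by norm_num) ht0
        _ ≤ 2 ^ b * t ^ p := by
          gcongr
          · norm_num
          · exact hp.2
    have h4 := mul_le_mul_of_nonneg_left gap hC
    have h5 : 2 ^ b / d * (d * t ^ p) = 2 ^ b * t ^ p := by field_simp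
    have h6 : 0 ≤ ε * (‖x‖ ^ p + ‖y‖ ^ p) := by positivity
    nlinarith

/-- Weighted AM–GM for `s ^ q` and `1` with weights `p / q` and `1 - p / q`. The error does not
depend on `s`, so the exponent can be lowered with no uniform control of the function. -/
theorem rpow_le_rpow_add_sub {s p q : ℝ} (hs : 0 ≤ s) (hp : 1 ≤ p) (hpq : p ≤ q) :
    s ^ p ≤ s ^ q + (q - p) := by
  have hq : 0 < q := by linarith
  have h := Real.geom_mean_le_arith_mean2_weighted (w₁ := p / q) (w₂ := 1 - p / q)
    (by positivity) (sub_nonneg.2 ((div_le_one hq).2 hpq)) (Real.rpow_nonneg hs q)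
    zero_le_one (by ring)
  rw [Real.one_rpow, ← Real.rpow_mul hs, mul_div_cancel₀ _ hq.ne'] at h
  have h1 : p / q * s ^ q ≤ s ^ q :=
    mul_le_of_le_one_left (Real.rpow_nonneg hs q) ((div_le_one hq).2 hpq)
  have h2 : 1 - p / q ≤ q - p := by
    rw [one_sub_div hq.ne', div_le_iff₀ hq]
    nlinarith
  linarith

theorem rpow_le_one_add_rpow {s p q : ℝ} (hs : 0 ≤ s) (hp : 0 ≤ p) (hpq : p ≤ q) :
    s ^ p ≤ 1 + s ^ q := by
  rcases le_total s 1 with h | h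
  · linarith [Real.rpow_le_one hs h hp, Real.rpow_nonneg hs q]
  · linarith [Real.rpow_le_rpow_of_exponent_le h hpq]

end Pointwise

theorem norm_add_rpow_le {E : Type*} [NormedAddCommGroup E] {p b : ℝ} (hp : 0 ≤ p) (hb : p ≤ b)
    (x y : E) :
    ‖x + y‖ ^ p ≤ 2 ^ b * (‖x‖ ^ p + ‖y‖ ^ p) := by
  have hx := Real.rpow_nonneg (norm_nonneg x) p
  have hy := Real.rpow_nonneg (norm_nonneg y) p
  calc ‖x + y‖ ^ p ≤ (2 * max ‖x‖ ‖y‖) ^ p := by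
        refine Real.rpow_le_rpow (norm_nonneg _) ?_ hp
        linarith [norm_add_le x y, le_max_left ‖x‖ ‖y‖, le_max_right ‖x‖ ‖y‖]
    _ = 2 ^ p * (max ‖x‖ ‖y‖) ^ p :=
        Real.mul_rpow (by norm_num) (le_max_of_le_left (norm_nonneg x))
    _ ≤ 2 ^ b * (‖x‖ ^ p + ‖y‖ ^ p) := by
      gcongr
      · norm_num
      · rcases max_choice ‖x‖ ‖y‖ with h | h <;> rw [h] <;> linarith

end VarExp

namespace VarExp

variable {N : ℕ}

/-! ### The modular and the Luxemburg norm -/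

/-- A measurable exponent on `Ω` with values in `[a, b]`, where `1 < a`. -/
structure BoundedExponent (Ω : Set (EuclideanSpace ℝ (Fin N)))
    (p : EuclideanSpace ℝ (Fin N) → ℝ) (a b : ℝ) : Prop where
  measurableSet : MeasurableSet Ω
  aemeasurable : AEMeasurable p (volume.restrict Ω)
  one_lt : 1 < a
  lower : ∀ x ∈ Ω, a ≤ p x
  upper : ∀ x ∈ Ω, p x ≤ b

theorem IsAdmissible.exists_boundedExponent {Ω : Set (EuclideanSpace ℝ (Fin N))}
    {p : EuclideanSpace ℝ (Fin N) → ℝ} (hp : IsAdmissible Ω p) (hΩ : IsOpen Ω) :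
    ∃ a b : ℝ, b < N ∧ BoundedExponent Ω p a b := by
  obtain ⟨a, ha, hpa⟩ := hp.one_lt_inf
  obtain ⟨b, hb, hpb⟩ := hp.sup_lt
  exact ⟨a, b, hb, hΩ.measurableSet,
    (hp.continuousOn.mono subset_closure).aemeasurable hΩ.measurableSet, ha, hpa, hpb⟩

variable {F : Type*} [NormedAddCommGroup F] {Ω : Set (EuclideanSpace ℝ (Fin N))}
  {p : EuclideanSpace ℝ (Fin N) → ℝ} {a b : ℝ}

theorem modular_congr_ae {f g : EuclideanSpace ℝ (Fin N) → F}
    (h : f =ᵐ[volume.restrict Ω] g) : modular Ω p f = modular Ω p g := by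
  refine lintegral_congr_ae ?_
  filter_upwards [h] with x hx
  rw [hx]

theorem modular_mono_norm {F' : Type*} [NormedAddCommGroup F'] (hp : BoundedExponent Ω p a b)
    {f : EuclideanSpace ℝ (Fin N) → F} {g : EuclideanSpace ℝ (Fin N) → F'}
    (h : ∀ x ∈ Ω, ‖f x‖ ≤ ‖g x‖) : modular Ω p f ≤ modular Ω p g := by
  refine setLIntegral_mono' hp.measurableSet fun x hx => ENNReal.ofReal_le_ofReal ?_
  exact Real.rpow_le_rpow (norm_nonneg _) (h x hx) (by linarith [hp.one_lt, hp.lower x hx])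

theorem BoundedExponent.aemeasurable_rpow (hp : BoundedExponent Ω p a b)
    {f : EuclideanSpace ℝ (Fin N) → F} (hf : AEStronglyMeasurable f (volume.restrict Ω)) :
    AEMeasurable (fun x => ENNReal.ofReal (‖f x‖ ^ p x)) (volume.restrict Ω) :=
  (hf.norm.aemeasurable.pow hp.aemeasurable).ennreal_ofReal

theorem modular_add_le (hp : BoundedExponent Ω p a b) {f g : EuclideanSpace ℝ (Fin N) → F}
    (hf : AEStronglyMeasurable f (volume.restrict Ω)) :
    modular Ω p (fun x => f x + g x) ≤ ENNReal.ofReal (2 ^ b) * (modular Ω p f + modular Ω p g) := by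
  unfold modular
  rw [← lintegral_add_left' (hp.aemeasurable_rpow hf),
    ← lintegral_const_mul' _ _ ENNReal.ofReal_ne_top]
  refine setLIntegral_mono' hp.measurableSet fun x hx => ?_
  rw [← ENNReal.ofReal_add (by positivity) (by positivity), ← ENNReal.ofReal_mul (by positivity)]
  exact ENNReal.ofReal_le_ofReal
    (norm_add_rpow_le (by linarith [hp.one_lt, hp.lower x hx]) (hp.upper x hx) _ _)

/-- Lower semicontinuity of the modular for almost everywhere convergence. -/
theorem modular_le_of_tendsto_ae (hp : BoundedExponent Ω p a b)
    {f : ℕ → EuclideanSpace ℝ (Fin N) → F} {g : EuclideanSpace ℝ (Fin N) → F} {C : ℝ≥0∞}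
    (hf : ∀ n, AEStronglyMeasurable (f n) (volume.restrict Ω))
    (hfg : ∀ᵐ x ∂volume.restrict Ω, Tendsto (fun n => f n x) atTop (𝓝 (g x)))
    (hC : ∀ᶠ n in atTop, modular Ω p (f n) ≤ C) : modular Ω p g ≤ C := by
  have h1 : modular Ω p g ≤ liminf (fun n => modular Ω p (f n)) atTop := by
    refine le_trans ?_ (lintegral_liminf_le' fun n => hp.aemeasurable_rpow (hf n))
    refine lintegral_mono_ae ?_
    filter_upwards [hfg, ae_restrict_mem hp.measurableSet] with x hx hxΩ
    refine le_of_eq (Tendsto.liminf_eq ?_).symm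
    refine ENNReal.tendsto_ofReal (Tendsto.rpow hx.norm tendsto_const_nhds (Or.inr ?_))
    linarith [hp.one_lt, hp.lower x hxΩ]
  exact h1.trans (liminf_le_of_frequently_le' hC.frequently)

theorem modular_le_modular_add {q : EuclideanSpace ℝ (Fin N) → ℝ} (hp : BoundedExponent Ω p a b)
    {δ : ℝ} (hδ : 0 ≤ δ) (hpq : ∀ x ∈ Ω, p x ≤ q x) (hqp : ∀ x ∈ Ω, q x ≤ p x + δ)
    (f : EuclideanSpace ℝ (Fin N) → F) :
    modular Ω p f ≤ modular Ω q f + ENNReal.ofReal δ * volume Ω := by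
  have : ENNReal.ofReal δ * volume Ω = ∫⁻ _ in Ω, ENNReal.ofReal δ := by
    rw [lintegral_const, Measure.restrict_apply_univ]
  unfold modular
  rw [this, ← lintegral_add_right _ measurable_const]
  refine setLIntegral_mono' hp.measurableSet fun x hx => ?_
  rw [← ENNReal.ofReal_add (by positivity) hδ]
  refine ENNReal.ofReal_le_ofReal ?_
  have := rpow_le_rpow_add_sub (norm_nonneg (f x))
    (by linarith [hp.one_lt, hp.lower x hx] : 1 ≤ p x) (hpq x hx)
  linarith [hqp x hx]

variable [NormedSpace ℝ F]

/-- The modular is not homogeneous, but `c ^ p x ≤ c` for `c ≤ 1` because `p > 1`; for `c ≥ 1` the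
bound is `c ^ b`. These two estimates replace homogeneity throughout. -/
theorem modular_smul_le_of_le_one (hp : BoundedExponent Ω p a b) {c : ℝ} (hc : 0 < c) (hc1 : c ≤ 1)
    (f : EuclideanSpace ℝ (Fin N) → F) :
    modular Ω p (fun x => c • f x) ≤ ENNReal.ofReal c * modular Ω p f := by
  unfold modular
  rw [← lintegral_const_mul' _ _ ENNReal.ofReal_ne_top]
  refine setLIntegral_mono' hp.measurableSet fun x hx => ?_
  rw [← ENNReal.ofReal_mul hc.le, norm_smul, Real.norm_of_nonneg hc.le,
    Real.mul_rpow hc.le (norm_nonneg _)]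
  refine ENNReal.ofReal_le_ofReal (mul_le_mul_of_nonneg_right ?_ (by positivity))
  simpa using Real.rpow_le_rpow_of_exponent_ge hc hc1
    (by linarith [hp.one_lt, hp.lower x hx] : (1 : ℝ) ≤ p x)

theorem modular_smul_le_of_one_le (hp : BoundedExponent Ω p a b) {c : ℝ} (hc1 : 1 ≤ c)
    (f : EuclideanSpace ℝ (Fin N) → F) :
    modular Ω p (fun x => c • f x) ≤ ENNReal.ofReal (c ^ b) * modular Ω p f := by
  unfold modular
  have hc : 0 ≤ c := by linarith
  rw [← lintegral_const_mul' _ _ ENNReal.ofReal_ne_top]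
  refine setLIntegral_mono' hp.measurableSet fun x hx => ?_
  rw [← ENNReal.ofReal_mul (by positivity), norm_smul, Real.norm_of_nonneg hc,
    Real.mul_rpow hc (norm_nonneg _)]
  refine ENNReal.ofReal_le_ofReal (mul_le_mul_of_nonneg_right ?_ (by positivity))
  exact Real.rpow_le_rpow_of_exponent_le hc1 (hp.upper x hx)

theorem modular_smul_lt_top (hp : BoundedExponent Ω p a b) (c : ℝ)
    {f : EuclideanSpace ℝ (Fin N) → F} (hf : modular Ω p f < ⊤) :
    modular Ω p (fun x => c • f x) < ⊤ := by
  have h : modular Ω p (fun x => c • f x) ≤ modular Ω p (fun x => max |c| 1 • f x) := by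
    refine modular_mono_norm hp fun x _ => ?_
    rw [norm_smul, norm_smul, Real.norm_eq_abs, Real.norm_eq_abs]
    exact mul_le_mul_of_nonneg_right ((le_max_left _ _).trans (le_abs_self _)) (norm_nonneg _)
  exact (h.trans (modular_smul_le_of_one_le hp (le_max_right _ _) f)).trans_lt
    (ENNReal.mul_lt_top ENNReal.ofReal_lt_top hf)

theorem luxNorm_le_of_modular_le {f : EuclideanSpace ℝ (Fin N) → F} {γ : ℝ} (hγ : 0 < γ)
    (h : modular Ω p (fun x => γ⁻¹ • f x) ≤ 1) : luxNorm Ω p f ≤ ENNReal.ofReal γ :=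
  iInf_le_of_le γ (iInf_le_of_le hγ (iInf_le_of_le h le_rfl))

theorem exists_of_luxNorm_lt {f : EuclideanSpace ℝ (Fin N) → F} {r : ℝ≥0∞}
    (h : luxNorm Ω p f < r) :
    ∃ γ : ℝ, 0 < γ ∧ modular Ω p (fun x => γ⁻¹ • f x) ≤ 1 ∧ ENNReal.ofReal γ < r := by
  simp only [luxNorm, iInf_lt_iff] at h
  obtain ⟨γ, h0, h1, h2⟩ := h
  exact ⟨γ, h0, h1, h2⟩

theorem modular_inv_smul_le_one_of_luxNorm_lt (hp : BoundedExponent Ω p a b)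
    {f : EuclideanSpace ℝ (Fin N) → F} {r : ℝ} (h : luxNorm Ω p f < ENNReal.ofReal r) :
    modular Ω p (fun x => r⁻¹ • f x) ≤ 1 := by
  obtain ⟨γ, h0, h1, h2⟩ := exists_of_luxNorm_lt h
  have hr : γ < r := (ENNReal.ofReal_lt_ofReal_iff_of_nonneg h0.le).1 h2
  refine (modular_mono_norm hp fun x _ => ?_).trans h1
  rw [norm_smul, norm_smul, Real.norm_of_nonneg (inv_nonneg.2 (h0.trans hr).le),
    Real.norm_of_nonneg (inv_nonneg.2 h0.le)]
  gcongr

theorem modular_le_of_luxNorm_lt (hp : BoundedExponent Ω p a b)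
    {f : EuclideanSpace ℝ (Fin N) → F} {r : ℝ} (hr : 0 < r) (hr1 : r ≤ 1)
    (h : luxNorm Ω p f < ENNReal.ofReal r) : modular Ω p f ≤ ENNReal.ofReal r := by
  have h1 := modular_smul_le_of_le_one hp hr hr1 (fun x => r⁻¹ • f x)
  simp only [smul_smul, mul_inv_cancel₀ hr.ne', one_smul] at h1
  exact h1.trans (mul_le_of_le_one_right' (modular_inv_smul_le_one_of_luxNorm_lt hp h))

/-- Dividing by `r` costs at most `r⁻¹ ^ b`. Together with `modular_le_of_luxNorm_lt`, this lets
smallness be handled through the modular alone. -/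
theorem luxNorm_le_of_modular_le_rpow (hp : BoundedExponent Ω p a b)
    {f : EuclideanSpace ℝ (Fin N) → F} {r : ℝ} (hr : 0 < r) (hr1 : r ≤ 1)
    (h : modular Ω p f ≤ ENNReal.ofReal (r ^ b)) : luxNorm Ω p f ≤ ENNReal.ofReal r := by
  refine luxNorm_le_of_modular_le hr ?_
  refine (modular_smul_le_of_one_le hp ((one_le_inv₀ hr).2 hr1) f).trans ?_
  calc _ ≤ ENNReal.ofReal (r⁻¹ ^ b) * ENNReal.ofReal (r ^ b) := by gcongr
    _ = 1 := by
      rw [← ENNReal.ofReal_mul (by positivity), ← Real.mul_rpow (by positivity) hr.le,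
        inv_mul_cancel₀ hr.ne', Real.one_rpow, ENNReal.ofReal_one]

theorem luxNorm_add_le (hp : BoundedExponent Ω p a b) {f g : EuclideanSpace ℝ (Fin N) → F}
    (hf : AEStronglyMeasurable f (volume.restrict Ω)) :
    luxNorm Ω p (fun x => f x + g x) ≤ luxNorm Ω p f + luxNorm Ω p g := by
  refine ENNReal.le_of_forall_pos_le_add fun ε hε hfin => ?_
  rw [ENNReal.add_lt_top] at hfin
  have hε2 : (0 : ℝ≥0∞) < ε / 2 := by simpa using hε.ne'
  obtain ⟨s, hs, hfs, hs'⟩ := exists_of_luxNorm_lt (ENNReal.lt_add_right hfin.1.ne hε2.ne')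
  obtain ⟨t, ht, hgt, ht'⟩ := exists_of_luxNorm_lt (ENNReal.lt_add_right hfin.2.ne hε2.ne')
  have hst : 0 < s + t := add_pos hs ht
  -- `(f + g) / (s + t)` is the convex combination of `f / s` and `g / t` with weights `s / (s + t)`
  -- and `t / (s + t)`.
  have key : modular Ω p (fun x => (s + t)⁻¹ • (f x + g x)) ≤ 1 := by
    calc modular Ω p (fun x => (s + t)⁻¹ • (f x + g x))
        ≤ ENNReal.ofReal (s / (s + t)) * modular Ω p (fun x => s⁻¹ • f x) +
            ENNReal.ofReal (t / (s + t)) * modular Ω p (fun x => t⁻¹ • g x) := by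
          unfold modular
          rw [← lintegral_const_mul' _ _ ENNReal.ofReal_ne_top,
            ← lintegral_const_mul' _ _ ENNReal.ofReal_ne_top,
            ← lintegral_add_left' ((hp.aemeasurable_rpow (f := fun x => s⁻¹ • f x)
              (hf.const_smul s⁻¹)).const_mul _)]
          refine setLIntegral_mono' hp.measurableSet fun x hx => ?_
          rw [← ENNReal.ofReal_mul (by positivity), ← ENNReal.ofReal_mul (by positivity),
            ← ENNReal.ofReal_add (by positivity) (by positivity)]
          refine ENNReal.ofReal_le_ofReal ?_
          have hpx : 1 ≤ p x := by linarith [hp.one_lt, hp.lower x hx]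
          have hc := (convexOn_rpow hpx).2 (Set.mem_Ici.2 (norm_nonneg (s⁻¹ • f x)))
            (Set.mem_Ici.2 (norm_nonneg (t⁻¹ • g x))) (by positivity : 0 ≤ s / (s + t))
            (by positivity : 0 ≤ t / (s + t)) (by field_simp)
          refine le_trans (Real.rpow_le_rpow (norm_nonneg _) ?_ (by linarith)) hc
          have e : (s + t)⁻¹ • (f x + g x) =
              (s / (s + t)) • s⁻¹ • f x + (t / (s + t)) • t⁻¹ • g x := by
            rw [smul_smul, smul_smul, smul_add]
            congr 2 <;> field_simp
          beta_reduce
          rw [e]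
          refine (norm_add_le _ _).trans (le_of_eq ?_)
          rw [norm_smul (s / (s + t)), norm_smul (t / (s + t)), Real.norm_of_nonneg (by positivity),
            Real.norm_of_nonneg (by positivity : 0 ≤ t / (s + t))]
          rfl
      _ ≤ ENNReal.ofReal (s / (s + t)) * 1 + ENNReal.ofReal (t / (s + t)) * 1 := by gcongr
      _ = 1 := by
        rw [mul_one, mul_one, ← ENNReal.ofReal_add (by positivity) (by positivity), ← add_div,
          div_self hst.ne', ENNReal.ofReal_one]
  calc luxNorm Ω p (fun x => f x + g x) ≤ ENNReal.ofReal (s + t) :=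
        luxNorm_le_of_modular_le hst key
    _ = ENNReal.ofReal s + ENNReal.ofReal t := ENNReal.ofReal_add hs.le ht.le
    _ ≤ (luxNorm Ω p f + ε / 2) + (luxNorm Ω p g + ε / 2) := add_le_add hs'.le ht'.le
    _ = luxNorm Ω p f + luxNorm Ω p g + ε := by
      rw [add_add_add_comm, ENNReal.add_halves]

/-- The `L¹` norm is controlled by the modular on sets of finite measure. -/
theorem lintegral_enorm_le_modular (hp : BoundedExponent Ω p a b) {ε : ℝ} (hε : 0 < ε) (hε1 : ε ≤ 1)
    (f : EuclideanSpace ℝ (Fin N) → F) :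
    ∫⁻ x in Ω, ‖f x‖ₑ ≤ ENNReal.ofReal ε * (volume Ω + ENNReal.ofReal (ε⁻¹ ^ b) * modular Ω p f) := by
  have h1 : ∫⁻ x in Ω, ‖f x‖ₑ ≤
      ∫⁻ x in Ω, ENNReal.ofReal ε * (1 + ENNReal.ofReal (‖ε⁻¹ • f x‖ ^ p x)) := by
    refine setLIntegral_mono' hp.measurableSet fun x hx => ?_
    rw [← ENNReal.ofReal_one, ← ENNReal.ofReal_add zero_le_one (by positivity),
      ← ENNReal.ofReal_mul hε.le, ← ofReal_norm]
    refine ENNReal.ofReal_le_ofReal ?_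
    -- The bound `τ ≤ 1 + τ ^ p` is applied to `τ = ‖f x‖ / ε`; the outer factor `ε` keeps the
    -- contribution of the constant `1` small.
    have h2 := rpow_le_one_add_rpow (norm_nonneg (ε⁻¹ • f x)) zero_le_one
      (by linarith [hp.one_lt, hp.lower x hx] : 1 ≤ p x)
    rw [Real.rpow_one] at h2
    calc ‖f x‖ = ε * ‖ε⁻¹ • f x‖ := by
          rw [norm_smul, Real.norm_of_nonneg (by positivity), mul_inv_cancel_left₀ hε.ne']
      _ ≤ _ := by gcongr
  refine h1.trans ?_
  rw [lintegral_const_mul' _ _ ENNReal.ofReal_ne_top, lintegral_add_left measurable_const,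
    lintegral_const, one_mul, Measure.restrict_apply_univ]
  gcongr
  exact modular_smul_le_of_one_le hp ((one_le_inv₀ hε).2 hε1) f

/-- Uniform convexity of the modular. -/
theorem exists_modular_uniform_convexity [StrictConvexSpace ℝ F] [ProperSpace F]
    (hp : BoundedExponent Ω p a b) {ε : ℝ} (hε : 0 < ε) : ∃ C : ℝ, 0 ≤ C ∧
      ∀ f g : EuclideanSpace ℝ (Fin N) → F, AEStronglyMeasurable f (volume.restrict Ω) →
      AEStronglyMeasurable g (volume.restrict Ω) →
      modular Ω p (fun x => f x - g x) +
        ENNReal.ofReal C * modular Ω p (fun x => (1 / 2 : ℝ) • (f x + g x)) ≤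
      ENNReal.ofReal (ε + C / 2) * (modular Ω p f + modular Ω p g) := by
  obtain ⟨C, hC, h⟩ := exists_uniform_convexity (E := F) (b := b) hp.one_lt hε
  refine ⟨C, hC, fun f g hf hg => ?_⟩
  unfold modular
  rw [← lintegral_const_mul' _ _ ENNReal.ofReal_ne_top,
    ← lintegral_add_left' (hp.aemeasurable_rpow (f := fun x => f x - g x) (hf.sub hg)),
    ← lintegral_add_left' (hp.aemeasurable_rpow hf),
    ← lintegral_const_mul' _ _ ENNReal.ofReal_ne_top]
  refine setLIntegral_mono' hp.measurableSet fun x hx => ?_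
  rw [← ENNReal.ofReal_mul hC, ← ENNReal.ofReal_add (by positivity) (by positivity),
    ← ENNReal.ofReal_add (by positivity) (by positivity), ← ENNReal.ofReal_mul (by positivity)]
  exact ENNReal.ofReal_le_ofReal (h (p x) ⟨hp.lower x hx, hp.upper x hx⟩ _ _)

end VarExp

namespace VarExp

variable {N : ℕ} {Ω : Set (EuclideanSpace ℝ (Fin N))} {p : EuclideanSpace ℝ (Fin N) → ℝ} {a b : ℝ}

/-! ### Test functions -/

namespace IsTestFunction

variable {φ ψ : EuclideanSpace ℝ (Fin N) → ℝ}

theorem differentiable (hφ : IsTestFunction Ω φ) : Differentiable ℝ φ :=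
  hφ.1.differentiable (by simp)

theorem add (hφ : IsTestFunction Ω φ) (hψ : IsTestFunction Ω ψ) :
    IsTestFunction Ω (fun x => φ x + ψ x) :=
  ⟨hφ.1.add hψ.1, hφ.2.1.add hψ.2.1,
    (tsupport_add φ ψ).trans (Set.union_subset hφ.2.2 hψ.2.2)⟩

theorem const_mul (hφ : IsTestFunction Ω φ) (c : ℝ) : IsTestFunction Ω (fun x => c * φ x) :=
  ⟨contDiff_const.mul hφ.1, hφ.2.1.mul_left, (tsupport_mul_subset_right).trans hφ.2.2⟩

theorem sub (hφ : IsTestFunction Ω φ) (hψ : IsTestFunction Ω ψ) :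
    IsTestFunction Ω (fun x => φ x - ψ x) := by
  simpa [sub_eq_add_neg] using hφ.add (hψ.const_mul (-1))

theorem gradient_add (hφ : IsTestFunction Ω φ) (hψ : IsTestFunction Ω ψ)
    (x : EuclideanSpace ℝ (Fin N)) :
    gradient (fun x => φ x + ψ x) x = gradient φ x + gradient ψ x := by
  unfold gradient
  rw [fderiv_fun_add hφ.differentiable.differentiableAt hψ.differentiable.differentiableAt, map_add]

theorem gradient_const_mul (hφ : IsTestFunction Ω φ) (c : ℝ) (x : EuclideanSpace ℝ (Fin N)) :
    gradient (fun x => c * φ x) x = c • gradient φ x := by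
  unfold gradient
  rw [fderiv_const_mul hφ.differentiable.differentiableAt]
  simp

theorem gradient_sub (hφ : IsTestFunction Ω φ) (hψ : IsTestFunction Ω ψ)
    (x : EuclideanSpace ℝ (Fin N)) :
    gradient (fun x => φ x - ψ x) x = gradient φ x - gradient ψ x := by
  unfold gradient
  rw [fderiv_fun_sub hφ.differentiable.differentiableAt hψ.differentiable.differentiableAt, map_sub]

theorem continuous_gradient (hφ : IsTestFunction Ω φ) : Continuous (gradient φ) :=
  (LinearIsometryEquiv.continuous _).comp (hφ.1.continuous_fderiv (by simp))

theorem integrable (hφ : IsTestFunction Ω φ) : Integrable φ (volume.restrict Ω) :=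
  (hφ.1.continuous.integrable_of_hasCompactSupport hφ.2.1).restrict

end IsTestFunction

theorem norm_gradient (φ : EuclideanSpace ℝ (Fin N) → ℝ) (x : EuclideanSpace ℝ (Fin N)) :
    ‖gradient φ x‖ = ‖fderiv ℝ φ x‖ :=
  LinearIsometryEquiv.norm_map _ _

/-! ### A Poincaré inequality for variable exponents -/

/-- Consequence of the Gagliardo–Nirenberg–Sobolev inequality: a bound of the gradient in `L^q`
improves integrability to the exponent `q + 1 / N`. -/
theorem exists_bound_lintegral_rpow_add {s : Set (EuclideanSpace ℝ (Fin N))}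
    (hs : Bornology.IsBounded s) {q : ℝ} (hq : 1 ≤ q) (hqN : q < N) {K : ℝ≥0∞} (hK : K < ⊤) :
    ∃ C : ℝ≥0∞, C < ⊤ ∧ ∀ g : EuclideanSpace ℝ (Fin N) → ℝ, ContDiff ℝ 1 g →
      Function.support g ⊆ s → ∫⁻ x, ENNReal.ofReal (‖fderiv ℝ g x‖ ^ q) ≤ K →
      ∫⁻ x, ENNReal.ofReal (‖g x‖ ^ (q + 1 / N)) ≤ C := by
  have hN : 0 < (N : ℝ) := by linarith
  have hq0 : 0 < q := by linarith
  lift q to ℝ≥0 using hq0.le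
  obtain ⟨r, hr⟩ : ∃ r : ℝ≥0, (r : ℝ) = q + 1 / N := ⟨q + 1 / N, by push_cast; rfl⟩
  have hr0 : 0 < (r : ℝ) := by rw [hr]; positivity
  set c : ℝ≥0 := eLpNormLESNormFDerivOfLeConst ℝ
    (volume : Measure (EuclideanSpace ℝ (Fin N))) s q r
  refine ⟨((c : ℝ≥0∞) * K ^ (1 / (q : ℝ))) ^ (r : ℝ), ?_, fun g hg hgs hK' => ?_⟩
  · refine ENNReal.rpow_lt_top_of_nonneg hr0.le (ENNReal.mul_lt_top ENNReal.coe_lt_top ?_).ne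
    exact ENNReal.rpow_lt_top_of_nonneg (by positivity) hK.ne
  have hpow : ∀ {V : Type} [NormedAddCommGroup V] (f : EuclideanSpace ℝ (Fin N) → V) (t : ℝ≥0),
      0 < (t : ℝ) → ∫⁻ x, ENNReal.ofReal (‖f x‖ ^ (t : ℝ)) = eLpNorm f t volume ^ (t : ℝ) := by
    intro V _ f t ht
    rw [eLpNorm_nnreal_pow_eq_lintegral (by exact_mod_cast ht.ne')]
    refine lintegral_congr fun x => ?_
    rw [← ENNReal.ofReal_rpow_of_nonneg (norm_nonneg _) ht.le, ofReal_norm]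
  rw [← hr, hpow g r hr0]
  rw [hpow _ q hq0] at hK'
  refine ENNReal.rpow_le_rpow ?_ hr0.le
  refine (eLpNorm_le_eLpNorm_fderiv_of_le volume hg hgs (by exact_mod_cast hq)
    (by rw [finrank_euclideanSpace_fin]; exact_mod_cast hqN) ?_ hs).trans ?_
  -- The Sobolev condition is `1 / q - 1 / r ≤ 1 / N`. With `r = q + 1 / N` the left side equals `(1
  -- / N) / (q * r)`, and `q * r ≥ 1`.
  · rw [finrank_euclideanSpace_fin, hr, sub_le_iff_le_add, ← sub_le_iff_le_add',
      NNReal.coe_inv, inv_sub_inv hq0.ne' (by positivity), add_sub_cancel_left, inv_eq_one_div,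
      div_le_iff₀ (by positivity)]
    refine le_mul_of_one_le_right (by positivity) ?_
    have : 0 ≤ 1 / (N : ℝ) := by positivity
    nlinarith
  · gcongr
    rw [one_div]
    exact (ENNReal.le_rpow_inv_iff hq0).2 hK'

theorem lintegral_fderiv_rpow_eq_setLIntegral {g : EuclideanSpace ℝ (Fin N) → ℝ}
    (hg : tsupport g ⊆ Ω) {q : ℝ} (hq : 0 < q) :
    ∫⁻ x, ENNReal.ofReal (‖fderiv ℝ g x‖ ^ q) = ∫⁻ x in Ω, ENNReal.ofReal (‖fderiv ℝ g x‖ ^ q) := by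
  refine (setLIntegral_eq_of_support_subset fun x hx => ?_).symm
  by_contra hxΩ
  refine hx ?_
  have : fderiv ℝ g x = 0 := by
    by_contra h
    exact hxΩ (hg (support_fderiv_subset ℝ h))
  simp [this, Real.zero_rpow hq.ne']

/-- Base of the bootstrap: the modular controls the `L¹` norm of the gradient, and Sobolev with `q =
1` reaches the exponent `1 + 1 / N`, more than enough since here `min (p x) 1 = 1`. -/
theorem exists_bound_modular_min_one (hΩ : Bornology.IsBounded Ω) (hN : 2 ≤ N)
    (hp : BoundedExponent Ω p a b) :
    ∃ C : ℝ≥0∞, C < ⊤ ∧ ∀ φ, IsTestFunction Ω φ → modular Ω p (gradient φ) ≤ 1 →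
      modular Ω (fun x => min (p x) 1) φ ≤ C := by
  have hN1 : (1 : ℝ) < N := by exact_mod_cast hN
  have hv : volume Ω < ⊤ := hΩ.measure_lt_top
  obtain ⟨C, hC, h⟩ := exists_bound_lintegral_rpow_add hΩ le_rfl hN1
    (K := volume Ω + 1) (ENNReal.add_lt_top.2 ⟨hv, ENNReal.one_lt_top⟩)
  refine ⟨volume Ω + C, ENNReal.add_lt_top.2 ⟨hv, hC⟩, fun φ hφ hgrad => ?_⟩
  have hsub : Function.support φ ⊆ Ω := (subset_tsupport φ).trans hφ.2.2
  have key := h φ (hφ.1.of_le (by exact_mod_cast le_top)) hsub (by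
    rw [lintegral_fderiv_rpow_eq_setLIntegral hφ.2.2 one_pos]
    have h1 := lintegral_enorm_le_modular hp one_pos le_rfl (gradient φ)
    simp only [ENNReal.ofReal_one, inv_one, Real.one_rpow, one_mul] at h1
    refine le_trans (le_of_eq ?_) (h1.trans (by gcongr))
    refine lintegral_congr fun x => ?_
    rw [Real.rpow_one, ← norm_gradient, ofReal_norm])
  calc modular Ω (fun x => min (p x) 1) φ
      ≤ ∫⁻ x in Ω, (1 + ENNReal.ofReal (‖φ x‖ ^ ((1 : ℝ) + 1 / N))) := by
        refine setLIntegral_mono' hp.measurableSet fun x hx => ?_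
        rw [← ENNReal.ofReal_one, ← ENNReal.ofReal_add zero_le_one (by positivity)]
        refine ENNReal.ofReal_le_ofReal ?_
        beta_reduce
        rw [min_eq_right (by linarith [hp.one_lt, hp.lower x hx])]
        exact rpow_le_one_add_rpow (norm_nonneg _) zero_le_one
          (by linarith [show 0 ≤ 1 / (N : ℝ) by positivity])
    _ = volume Ω + ∫⁻ x in Ω, ENNReal.ofReal (‖φ x‖ ^ ((1 : ℝ) + 1 / N)) := by
        rw [lintegral_add_left measurable_const, lintegral_const, one_mul,
          Measure.restrict_apply_univ]
    _ ≤ _ := by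
        gcongr
        exact (setLIntegral_le_lintegral _ _).trans key

/-- The local step in the improvement of integrability: near a point, the exponent of integrability
of test functions gains `1 / N`. -/
theorem exists_nhds_bound_modular_min (hΩ : Bornology.IsBounded Ω)
    (hp : BoundedExponent Ω p a b) {s : ℝ} (hs : 1 ≤ s)
    {x₀ : EuclideanSpace ℝ (Fin N)} {R P : ℝ} (hR : 0 < R) (hP : 1 ≤ P) (hPN : P < N)
    (hPp : ∀ x ∈ Ω ∩ Metric.ball x₀ R, P ≤ p x) (hpP : ∀ x ∈ Ω ∩ Metric.ball x₀ R, p x ≤ P + 1 / N)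
    (hS : ∃ C : ℝ≥0∞, C < ⊤ ∧ ∀ φ, IsTestFunction Ω φ → modular Ω p (gradient φ) ≤ 1 →
      modular Ω (fun x => min (p x) s) φ ≤ C) :
    ∃ t ∈ 𝓝 x₀, ∃ C : ℝ≥0∞, C < ⊤ ∧ ∀ φ, IsTestFunction Ω φ → modular Ω p (gradient φ) ≤ 1 →
      ∫⁻ x in t ∩ Ω, ENNReal.ofReal (‖φ x‖ ^ min (p x) (s + 1 / N)) ≤ C := by
  obtain ⟨C₀, hC₀, hS⟩ := hS
  have hN0 : 0 < 1 / (N : ℝ) := by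
    have : 0 < (N : ℝ) := by linarith
    positivity
  have hv : volume Ω < ⊤ := hΩ.measure_lt_top
  let η : ContDiffBump x₀ := ⟨R / 4, R / 2, by positivity, by linarith⟩
  have hη : ContDiff ℝ ∞ (η : EuclideanSpace ℝ (Fin N) → ℝ) := η.contDiff
  obtain ⟨D, hD⟩ := (η.hasCompactSupport.fderiv ℝ).exists_bound_of_continuous
    (hη.continuous_fderiv (by simp))
  have hD0 : 0 ≤ D := (norm_nonneg _).trans (hD x₀)
  -- Near `x₀`, `q ≤ p` and `q ≤ min p s`, so both terms of `∇(η φ) = η ∇φ + φ ∇η` are bounded in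
  -- `L^q`. Sobolev yields `q + 1 / N = min (P + 1 / N) (s + 1 / N)`, which dominates the target
  -- exponent because `p ≤ P + 1 / N` there.
  set q := min P s with hq
  have hq1 : 1 ≤ q := le_min hP hs
  have hqN : q < N := (min_le_left _ _).trans_lt hPN
  set c : ℝ := 2 ^ q * (1 + D ^ q) with hc
  have hc0 : 0 ≤ c := by positivity
  obtain ⟨C, hC, h⟩ := exists_bound_lintegral_rpow_add hΩ hq1 hqN
    (K := ENNReal.ofReal c * (2 * volume Ω + 1 + C₀))
    (ENNReal.mul_lt_top ENNReal.ofReal_lt_top (ENNReal.add_lt_top.2 ⟨ENNReal.add_lt_top.2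
      ⟨ENNReal.mul_lt_top (by simp) hv, ENNReal.one_lt_top⟩, hC₀⟩))
  refine ⟨Metric.ball x₀ (R / 4), Metric.ball_mem_nhds _ (by positivity), volume Ω + C,
    ENNReal.add_lt_top.2 ⟨hv, hC⟩, fun φ hφ hgrad => ?_⟩
  set g : EuclideanSpace ℝ (Fin N) → ℝ := fun x => η x * φ x with hg
  have hgts : tsupport g ⊆ Ω := (tsupport_mul_subset_right).trans hφ.2.2
  have hgη : tsupport g ⊆ Metric.ball x₀ R := by
    refine (tsupport_mul_subset_left).trans ?_
    rw [η.tsupport_eq]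
    exact Metric.closedBall_subset_ball (by change R / 2 < R; linarith)
  have hfd : ∀ x ∈ Ω, ‖fderiv ℝ g x‖ ^ q ≤
      c * (2 + ‖gradient φ x‖ ^ p x + ‖φ x‖ ^ min (p x) s) := by
    intro x hx
    by_cases hxg : x ∈ tsupport g
    · have hxB := hgη hxg
      have hpx := hPp x ⟨hx, hxB⟩
      have e : fderiv ℝ g x = η x • fderiv ℝ φ x + φ x • fderiv ℝ η x :=
        fderiv_mul (hη.differentiable (by simp)).differentiableAt
          hφ.differentiable.differentiableAt
      have h1 : ‖η x • fderiv ℝ φ x‖ ^ q ≤ 1 + ‖gradient φ x‖ ^ p x := by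
        refine le_trans (Real.rpow_le_rpow (norm_nonneg _) ?_ (by linarith))
          (rpow_le_one_add_rpow (norm_nonneg (gradient φ x)) (by linarith)
            ((min_le_left _ _).trans hpx))
        rw [norm_smul, norm_gradient, Real.norm_of_nonneg η.nonneg]
        exact mul_le_of_le_one_left (norm_nonneg _) η.le_one
      have h2 : ‖φ x • fderiv ℝ η x‖ ^ q ≤ D ^ q * (1 + ‖φ x‖ ^ min (p x) s) := by
        calc ‖φ x • fderiv ℝ η x‖ ^ q ≤ (D * ‖φ x‖) ^ q := by
              refine Real.rpow_le_rpow (norm_nonneg _) ?_ (by linarith)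
              rw [norm_smul, mul_comm]
              exact mul_le_mul_of_nonneg_right (hD x) (norm_nonneg _)
          _ = D ^ q * ‖φ x‖ ^ q := Real.mul_rpow hD0 (norm_nonneg _)
          _ ≤ _ := by
            gcongr
            exact rpow_le_one_add_rpow (norm_nonneg _) (by linarith) (min_le_min_right s hpx)
      rw [e]
      have hDq : 0 ≤ D ^ q := by positivity
      have hA : 0 ≤ ‖gradient φ x‖ ^ p x := by positivity
      have hB : 0 ≤ ‖φ x‖ ^ min (p x) s := by positivity
      calc _ ≤ 2 ^ q * (‖η x • fderiv ℝ φ x‖ ^ q + ‖φ x • fderiv ℝ η x‖ ^ q) :=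
            norm_add_rpow_le (by linarith) le_rfl _ _
        _ ≤ 2 ^ q * ((1 + ‖gradient φ x‖ ^ p x) + D ^ q * (1 + ‖φ x‖ ^ min (p x) s)) := by gcongr
        _ ≤ 2 ^ q * ((1 + D ^ q) * (2 + ‖gradient φ x‖ ^ p x + ‖φ x‖ ^ min (p x) s)) := by
            gcongr
            nlinarith [mul_nonneg hDq hA]
        _ = _ := by rw [hc]; ring
    · have : fderiv ℝ g x = 0 := by
        by_contra h
        exact hxg (support_fderiv_subset ℝ h)
      rw [this, norm_zero, Real.zero_rpow (by linarith)]
      positivity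
  have key := h g (hη.mul hφ.1 |>.of_le (by exact_mod_cast le_top))
    ((subset_tsupport g).trans hgts) (by
      rw [lintegral_fderiv_rpow_eq_setLIntegral hgts (by linarith)]
      calc ∫⁻ x in Ω, ENNReal.ofReal (‖fderiv ℝ g x‖ ^ q)
          ≤ ∫⁻ x in Ω, ENNReal.ofReal c * (2 + ENNReal.ofReal (‖gradient φ x‖ ^ p x) +
              ENNReal.ofReal (‖φ x‖ ^ min (p x) s)) := by
            refine setLIntegral_mono' hp.measurableSet fun x hx => ?_
            refine (ENNReal.ofReal_le_ofReal (hfd x hx)).trans (le_of_eq ?_)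
            rw [ENNReal.ofReal_mul hc0, ENNReal.ofReal_add (by positivity) (by positivity),
              ENNReal.ofReal_add (by norm_num) (by positivity), ENNReal.ofReal_ofNat]
        _ = ENNReal.ofReal c * (2 * volume Ω + modular Ω p (gradient φ) +
              modular Ω (fun x => min (p x) s) φ) := by
            rw [lintegral_const_mul' _ _ ENNReal.ofReal_ne_top,
              lintegral_add_left' (f := fun x => 2 + ENNReal.ofReal (‖gradient φ x‖ ^ p x))
                (aemeasurable_const.add (hp.aemeasurable_rpow
                  hφ.continuous_gradient.aestronglyMeasurable)),
              lintegral_add_left measurable_const, lintegral_const, Measure.restrict_apply_univ]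
            rfl
        _ ≤ _ := by
            gcongr
            exact hS φ hφ hgrad)
  calc ∫⁻ x in Metric.ball x₀ (R / 4) ∩ Ω, ENNReal.ofReal (‖φ x‖ ^ min (p x) (s + 1 / N))
      ≤ ∫⁻ x in Metric.ball x₀ (R / 4) ∩ Ω, (1 + ENNReal.ofReal (‖g x‖ ^ (q + 1 / N))) := by
        refine setLIntegral_mono' (measurableSet_ball.inter hp.measurableSet) fun x hx => ?_
        have hx1 : x ∈ Ω ∩ Metric.ball x₀ R :=
          ⟨hx.2, Metric.ball_subset_ball (by linarith) hx.1⟩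
        have hgx : g x = φ x := by
          rw [hg]
          beta_reduce
          rw [η.one_of_mem_closedBall (Metric.ball_subset_closedBall hx.1), one_mul]
        rw [← ENNReal.ofReal_one, ← ENNReal.ofReal_add zero_le_one (by positivity), hgx]
        refine ENNReal.ofReal_le_ofReal (rpow_le_one_add_rpow (norm_nonneg _) ?_ ?_)
        · exact le_min (by linarith [hPp x hx1]) (by linarith)
        · rw [hq, min_add_add_right P s (1 / (N : ℝ)) |>.symm]
          exact min_le_min_right _ (hpP x hx1)
    _ ≤ ∫⁻ x in Ω, (1 + ENNReal.ofReal (‖g x‖ ^ (q + 1 / N))) :=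
        lintegral_mono_set Set.inter_subset_right
    _ = volume Ω + ∫⁻ x in Ω, ENNReal.ofReal (‖g x‖ ^ (q + 1 / N)) := by
        rw [lintegral_add_left measurable_const, lintegral_const, one_mul,
          Measure.restrict_apply_univ]
    _ ≤ _ := by
        gcongr
        exact (setLIntegral_le_lintegral _ _).trans key

/-- By continuity up to the boundary, `p` oscillates by less than `1 / N` on a ball around each
point of the compact closure. The local gain applies on each ball and finitely many neighbourhoods
suffice. -/
theorem exists_bound_modular_min_add (hΩ : Bornology.IsBounded Ω) (hN : 2 ≤ N)
    (hp : BoundedExponent Ω p a b) (hb : b < N) (hcont : ContinuousOn p (closure Ω)) {s : ℝ}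
    (hs : 1 ≤ s)
    (hS : ∃ C : ℝ≥0∞, C < ⊤ ∧ ∀ φ, IsTestFunction Ω φ → modular Ω p (gradient φ) ≤ 1 →
      modular Ω (fun x => min (p x) s) φ ≤ C) :
    ∃ C : ℝ≥0∞, C < ⊤ ∧ ∀ φ, IsTestFunction Ω φ → modular Ω p (gradient φ) ≤ 1 →
      modular Ω (fun x => min (p x) (s + 1 / N)) φ ≤ C := by
  have hN1 : (1 : ℝ) < N := by exact_mod_cast hN
  have hN0 : 0 < 1 / (N : ℝ) := by
    have : 0 < (N : ℝ) := by linarith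
    positivity
  have key : ∃ C : ℝ≥0∞, C < ⊤ ∧ ∀ φ, IsTestFunction Ω φ → modular Ω p (gradient φ) ≤ 1 →
      ∫⁻ x in closure Ω ∩ Ω, ENNReal.ofReal (‖φ x‖ ^ min (p x) (s + 1 / N)) ≤ C := by
    refine hΩ.isCompact_closure.induction_on (p := fun t => ∃ C : ℝ≥0∞, C < ⊤ ∧
      ∀ φ, IsTestFunction Ω φ → modular Ω p (gradient φ) ≤ 1 →
      ∫⁻ x in t ∩ Ω, ENNReal.ofReal (‖φ x‖ ^ min (p x) (s + 1 / N)) ≤ C) ?_ ?_ ?_ ?_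
    · exact ⟨0, by simp, fun φ _ _ => by simp⟩
    · rintro t t' htt' ⟨C, hC, h⟩
      exact ⟨C, hC, fun φ hφ hg =>
        (lintegral_mono_set (Set.inter_subset_inter_left _ htt')).trans (h φ hφ hg)⟩
    · rintro t t' ⟨C, hC, h⟩ ⟨C', hC', h'⟩
      refine ⟨C + C', ENNReal.add_lt_top.2 ⟨hC, hC'⟩, fun φ hφ hg => ?_⟩
      rw [Set.union_inter_distrib_right]
      exact (lintegral_union_le _ _ _).trans (add_le_add (h φ hφ hg) (h' φ hφ hg))
    · intro x₀ hx₀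
      obtain ⟨R, hR, hclose⟩ := Metric.continuousWithinAt_iff.1 (hcont x₀ hx₀) (1 / (2 * N))
        (by positivity)
      have hhalf : 1 / (2 * (N : ℝ)) + 1 / (2 * N) = 1 / N := by
        field_simp
        norm_num
      have hpx₀ : p x₀ ≤ b :=
        ContinuousWithinAt.closure_le hx₀ ((hcont x₀ hx₀).mono subset_closure)
          continuousWithinAt_const hp.upper
      have hpc : ∀ x ∈ Ω ∩ Metric.ball x₀ R, |p x - p x₀| < 1 / (2 * N) := fun x hx => by
        simpa [Real.dist_eq] using hclose (subset_closure hx.1) hx.2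
      obtain ⟨t, ht, hbound⟩ := exists_nhds_bound_modular_min hΩ hp hs hR
        -- Lower bound of `p` on the ball: `p` stays within `1 / (2 * N)` of `p x₀`, hence below `P
        -- + 1 / N`. Also `P < N`, as `p x₀ ≤ b` by continuity.
        (P := max 1 (p x₀ - 1 / (2 * N))) (le_max_left _ _)
        (max_lt hN1 (by linarith [show 0 < 1 / (2 * (N : ℝ)) by positivity]))
        (fun x hx => max_le (hp.one_lt.le.trans (hp.lower x hx.1))
          (by linarith [(abs_lt.1 (hpc x hx)).1]))
        (fun x hx => by
          linarith [(abs_lt.1 (hpc x hx)).2, le_max_right 1 (p x₀ - 1 / (2 * N))]) hS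
      exact ⟨t, mem_nhdsWithin_of_mem_nhds ht, hbound⟩
  rwa [Set.inter_eq_right.2 subset_closure] at key

/-- A nonlinear Poincaré inequality: for test functions, a bound of the modular of the gradient
gives a bound of the modular of the function. -/
theorem exists_bound_modular_of_gradient (hΩ : Bornology.IsBounded Ω) (hN : 2 ≤ N)
    (hp : BoundedExponent Ω p a b) (hb : b < N) (hcont : ContinuousOn p (closure Ω)) :
    ∃ C : ℝ≥0∞, C < ⊤ ∧ ∀ φ, IsTestFunction Ω φ → modular Ω p (gradient φ) ≤ 1 →
      modular Ω p φ ≤ C := by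
  have hN0 : 0 < (N : ℝ) := by positivity
  have hstep : ∀ k : ℕ, ∃ C : ℝ≥0∞, C < ⊤ ∧ ∀ φ, IsTestFunction Ω φ →
      modular Ω p (gradient φ) ≤ 1 → modular Ω (fun x => min (p x) (1 + k * (1 / N))) φ ≤ C := by
    intro k
    induction k with
    | zero => simpa using exists_bound_modular_min_one hΩ hN hp
    | succ k ih =>
      have := exists_bound_modular_min_add hΩ hN hp hb hcont
        (le_add_of_nonneg_right (by positivity)) ih
      simpa only [Nat.cast_succ, add_mul, one_mul, add_assoc] using this
  -- After `N * N` gains of `1 / N` the level is `1 + N > b`, and the truncation of `p` disappears.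
  obtain ⟨C, hC, h⟩ := hstep (N * N)
  refine ⟨C, hC, fun φ hφ hg => (le_of_eq ?_).trans (h φ hφ hg)⟩
  refine setLIntegral_congr_fun hp.measurableSet fun x hx => ?_
  beta_reduce
  rw [min_eq_left]
  have : ((N * N : ℕ) : ℝ) * (1 / N) = N := by
    push_cast
    field_simp
  rw [this]
  linarith [hp.upper x hx]

end VarExp

namespace VarExp

variable {N : ℕ} {Ω : Set (EuclideanSpace ℝ (Fin N))} {p : EuclideanSpace ℝ (Fin N) → ℝ} {a b : ℝ}

/-! ### Weak gradients -/

theorem IsTestFunction.integrable_smul {F : Type*} [NormedAddCommGroup F] [NormedSpace ℝ F]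
    {ψ : EuclideanSpace ℝ (Fin N) → ℝ} (hψ : IsTestFunction Ω ψ) (hΩ : IsOpen Ω)
    {G : EuclideanSpace ℝ (Fin N) → F} (hG : LocallyIntegrableOn G Ω) :
    Integrable (fun x => ψ x • G x) := by
  have h := (hG.continuousOn_smul hΩ.isLocallyClosed
    hψ.1.continuous.continuousOn).integrableOn_compact_subset hψ.2.2 hψ.2.1
  refine (integrableOn_iff_integrable_of_support_subset fun x hx => ?_).1 h
  refine subset_tsupport ψ fun h0 => hx ?_
  simp [h0]

/-- The fundamental lemma of the calculus of variations. It makes the choice in `weakGradient`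
harmless, since the modular sees only almost everywhere classes. -/
theorem HasWeakGradient.ae_eq {u : EuclideanSpace ℝ (Fin N) → ℝ}
    {G G' : EuclideanSpace ℝ (Fin N) → EuclideanSpace ℝ (Fin N)} (hΩ : IsOpen Ω)
    (hG : HasWeakGradient Ω u G) (hG' : HasWeakGradient Ω u G') :
    G =ᵐ[volume.restrict Ω] G' := by
  have key := hΩ.ae_eq_zero_of_integral_contDiff_smul_eq_zero (hG.2.1.sub hG'.2.1)
    (fun ψ h1 h2 h3 => by
      have hψ : IsTestFunction Ω ψ := ⟨h1, h2, h3⟩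
      have hi := hψ.integrable_smul hΩ hG.2.1
      have hi' := hψ.integrable_smul hΩ hG'.2.1
      have hint : ∀ {H : EuclideanSpace ℝ (Fin N) → EuclideanSpace ℝ (Fin N)},
          Integrable (fun x => ψ x • H x) → ∀ e : EuclideanSpace ℝ (Fin N),
          ∫ x in Ω, ψ x * inner ℝ (H x) e = inner ℝ e (∫ x, ψ x • H x) := by
        intro H hH e
        rw [setIntegral_eq_integral_of_forall_compl_eq_zero, ← integral_inner hH]
        · refine integral_congr_ae (Eventually.of_forall fun x => ?_)
          beta_reduce
          rw [inner_smul_right, real_inner_comm]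
        · intro x hx
          rw [image_eq_zero_of_notMem_tsupport fun h => hx (h3 h), zero_mul]
      have heq : ∫ x, ψ x • G x = ∫ x, ψ x • G' x := by
        refine ext_inner_left ℝ fun e => ?_
        rw [← hint hi e, ← hint hi' e]
        exact neg_injective ((hG.2.2 ψ hψ e).symm.trans (hG'.2.2 ψ hψ e))
      simp only [Pi.sub_apply, smul_sub]
      rw [integral_sub hi hi', heq, sub_self])
  filter_upwards [ae_restrict_of_ae key, ae_restrict_mem hΩ.measurableSet] with x hx hxΩ
  exact sub_eq_zero.1 (hx hxΩ)

theorem weakGradient_ae_eq {u : EuclideanSpace ℝ (Fin N) → ℝ}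
    {G : EuclideanSpace ℝ (Fin N) → EuclideanSpace ℝ (Fin N)} (hΩ : IsOpen Ω)
    (hG : HasWeakGradient Ω u G) : weakGradient Ω u =ᵐ[volume.restrict Ω] G := by
  have h : ∃ G, HasWeakGradient Ω u G := ⟨G, hG⟩
  rw [weakGradient, dif_pos h]
  exact h.choose_spec.ae_eq hΩ hG

theorem IsTestFunction.integral_mul_fderiv {φ ψ : EuclideanSpace ℝ (Fin N) → ℝ}
    (hφ : IsTestFunction Ω φ) (hψ : IsTestFunction Ω ψ) (e : EuclideanSpace ℝ (Fin N)) :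
    ∫ x in Ω, φ x * fderiv ℝ ψ x e = -∫ x in Ω, ψ x * inner ℝ (gradient φ x) e := by
  have hc : ∀ {f : EuclideanSpace ℝ (Fin N) → ℝ}, IsTestFunction Ω f →
      Continuous fun x => fderiv ℝ f x e := fun hf =>
    (hf.1.continuous_fderiv (by simp)).clm_apply continuous_const
  have hφc := hφ.1.continuous
  have hψc := hψ.1.continuous
  have key := integral_mul_fderiv_eq_neg_fderiv_mul_of_integrable
    (μ := (volume : Measure (EuclideanSpace ℝ (Fin N)))) (f := φ) (g := ψ) (v := e)
    (((hc hφ).mul hψc).integrable_of_hasCompactSupport hψ.2.1.mul_left)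
    ((hφc.mul (hc hψ)).integrable_of_hasCompactSupport hφ.2.1.mul_right)
    ((hφc.mul hψc).integrable_of_hasCompactSupport hφ.2.1.mul_right)
    (fun x _ => hφ.differentiable.differentiableAt) (fun x _ => hψ.differentiable.differentiableAt)
  rw [setIntegral_eq_integral_of_forall_compl_eq_zero, key,
    setIntegral_eq_integral_of_forall_compl_eq_zero]
  · simp_rw [inner_gradient_left, mul_comm]
  · intro x hx
    rw [image_eq_zero_of_notMem_tsupport fun h => hx (hψ.2.2 h), zero_mul]
  · intro x hx
    rw [image_eq_zero_of_notMem_tsupport fun h => hx (hφ.2.2 h), zero_mul]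

theorem tendsto_integral_mul_of_tendsto_lintegral {α : Type*} [MeasurableSpace α] {μ : Measure α}
    {f : ℕ → α → ℝ} {g w : α → ℝ} {D : ℝ} (hf : ∀ n, Integrable (f n) μ) (hg : Integrable g μ)
    (hw : AEStronglyMeasurable w μ) (hD : ∀ x, ‖w x‖ ≤ D)
    (h : Tendsto (fun n => ∫⁻ x, ‖f n x - g x‖ₑ ∂μ) atTop (𝓝 0)) :
    Tendsto (fun n => ∫ x, f n x * w x ∂μ) atTop (𝓝 (∫ x, g x * w x ∂μ)) := by
  refine tendsto_integral_of_L1 _ (hg.aestronglyMeasurable.mul hw)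
    (Eventually.of_forall fun n => (hf n).mul_bdd hw (Eventually.of_forall hD)) ?_
  have h0 : Tendsto (fun n => ENNReal.ofReal D * ∫⁻ x, ‖f n x - g x‖ₑ ∂μ) atTop (𝓝 0) := by
    simpa using ENNReal.Tendsto.const_mul h (Or.inr ENNReal.ofReal_ne_top)
  refine tendsto_of_tendsto_of_tendsto_of_le_of_le tendsto_const_nhds h0 (fun _ => zero_le)
    fun n => ?_
  beta_reduce
  rw [← lintegral_const_mul' _ _ ENNReal.ofReal_ne_top]
  refine lintegral_mono fun x => ?_
  rw [Pi.mul_apply, ← sub_mul, enorm_mul, mul_comm]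
  gcongr
  rw [← ofReal_norm]
  exact ENNReal.ofReal_le_ofReal (hD x)

/-- Weak gradients are stable under `L¹` limits of test functions and their gradients. -/
theorem hasWeakGradient_of_tendsto {φ : ℕ → EuclideanSpace ℝ (Fin N) → ℝ}
    (hφ : ∀ n, IsTestFunction Ω (φ n)) {u : EuclideanSpace ℝ (Fin N) → ℝ}
    {G : EuclideanSpace ℝ (Fin N) → EuclideanSpace ℝ (Fin N)}
    (hu : Integrable u (volume.restrict Ω)) (hG : Integrable G (volume.restrict Ω))
    (hφu : Tendsto (fun n => ∫⁻ x in Ω, ‖φ n x - u x‖ₑ) atTop (𝓝 0))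
    (hφG : Tendsto (fun n => ∫⁻ x in Ω, ‖gradient (φ n) x - G x‖ₑ) atTop (𝓝 0)) :
    HasWeakGradient Ω u G := by
  refine ⟨IntegrableOn.locallyIntegrableOn hu, IntegrableOn.locallyIntegrableOn hG,
    fun ψ hψ e => ?_⟩
  have hgi : ∀ n, Integrable (gradient (φ n)) (volume.restrict Ω) := fun n => by
    refine (Continuous.integrable_of_hasCompactSupport (hφ n).continuous_gradient ?_).restrict
    exact ((hφ n).2.1.fderiv ℝ).comp_left (map_zero _)
  have hψ' : Continuous fun x => fderiv ℝ ψ x e :=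
    (hψ.1.continuous_fderiv (by simp)).clm_apply continuous_const
  obtain ⟨D, hD⟩ := (hψ.2.1.fderiv_apply ℝ e).exists_bound_of_continuous hψ'
  obtain ⟨D', hD'⟩ := hψ.2.1.exists_bound_of_continuous hψ.1.continuous
  have h1 := tendsto_integral_mul_of_tendsto_lintegral (fun n => (hφ n).integrable) hu
    hψ'.aestronglyMeasurable hD hφu
  have h2 : Tendsto (fun n => ∫ x in Ω, ψ x * inner ℝ (gradient (φ n) x) e) atTop
      (𝓝 (∫ x in Ω, ψ x * inner ℝ (G x) e)) := by
    simp_rw [mul_comm (ψ _)]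
    refine tendsto_integral_mul_of_tendsto_lintegral (fun n => (hgi n).inner_const e)
      (hG.inner_const e) hψ.1.continuous.aestronglyMeasurable hD' ?_
    have h0 : Tendsto (fun n => ENNReal.ofReal ‖e‖ * ∫⁻ x in Ω, ‖gradient (φ n) x - G x‖ₑ)
        atTop (𝓝 0) := by
      simpa only [mul_zero] using ENNReal.Tendsto.const_mul hφG (Or.inr ENNReal.ofReal_ne_top)
    refine tendsto_of_tendsto_of_tendsto_of_le_of_le tendsto_const_nhds h0 (fun _ => zero_le)
      fun n => ?_
    beta_reduce
    rw [← lintegral_const_mul' _ _ ENNReal.ofReal_ne_top]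
    refine lintegral_mono fun x => ?_
    rw [← inner_sub_left, ← ofReal_norm, ← ofReal_norm, ← ENNReal.ofReal_mul (norm_nonneg _),
      mul_comm]
    exact ENNReal.ofReal_le_ofReal (norm_inner_le_norm _ _)
  simp_rw [(hφ _).integral_mul_fderiv hψ e] at h1
  exact tendsto_nhds_unique h1 h2.neg

end VarExp

namespace VarExp

variable {N : ℕ} {Ω : Set (EuclideanSpace ℝ (Fin N))} {p : EuclideanSpace ℝ (Fin N) → ℝ} {a b : ℝ}

/-! ### Modular convergence -/

section Convergence

variable {F : Type*} [NormedAddCommGroup F]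

theorem exists_lintegral_enorm_le_of_modular_le [NormedSpace ℝ F] (hp : BoundedExponent Ω p a b)
    (hΩ : volume Ω < ⊤) {ε : ℝ} (hε : 0 < ε) :
    ∃ δ : ℝ, 0 < δ ∧ ∀ f : EuclideanSpace ℝ (Fin N) → F, modular Ω p f ≤ ENNReal.ofReal δ →
      ∫⁻ x in Ω, ‖f x‖ₑ ≤ ENNReal.ofReal ε := by
  set V := (volume Ω).toReal with hV
  have hV0 : 0 ≤ V := ENNReal.toReal_nonneg
  have hVΩ : volume Ω = ENNReal.ofReal V := (ENNReal.ofReal_toReal hΩ.ne).symm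
  have ht0 : 0 < min 1 (ε / (V + 1)) := lt_min one_pos (by positivity)
  set t := min 1 (ε / (V + 1))
  -- `t` is chosen with `t * (|Ω| + 1) ≤ ε`; then `δ = t ^ b` cancels the factor `t⁻¹ ^ b`.
  refine ⟨t ^ b, by positivity, fun f hf => ?_⟩
  calc ∫⁻ x in Ω, ‖f x‖ₑ
      ≤ ENNReal.ofReal t * (volume Ω + ENNReal.ofReal (t⁻¹ ^ b) * modular Ω p f) :=
        lintegral_enorm_le_modular hp ht0 (min_le_left _ _) f
    _ ≤ ENNReal.ofReal t * (volume Ω + ENNReal.ofReal (t⁻¹ ^ b) * ENNReal.ofReal (t ^ b)) := by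
        gcongr
    _ = ENNReal.ofReal (t * (V + 1)) := by
        rw [hVΩ, ← ENNReal.ofReal_mul (by positivity), ← Real.mul_rpow (by positivity) ht0.le,
          inv_mul_cancel₀ ht0.ne', Real.one_rpow, ← ENNReal.ofReal_add hV0 zero_le_one,
          ← ENNReal.ofReal_mul ht0.le]
    _ ≤ ENNReal.ofReal ε := by
        refine ENNReal.ofReal_le_ofReal ?_
        rw [← le_div_iff₀ (by positivity)]
        exact min_le_right _ _

theorem modular_lt_top_of_bounded (hp : BoundedExponent Ω p a b) (hΩ : volume Ω < ⊤)
    {f : EuclideanSpace ℝ (Fin N) → F} {D : ℝ} (hD : ∀ x, ‖f x‖ ≤ D) : modular Ω p f < ⊤ := by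
  have h : modular Ω p f ≤ ∫⁻ _ in Ω, ENNReal.ofReal (1 + max D 0 ^ b) := by
    refine setLIntegral_mono' hp.measurableSet fun x hx => ENNReal.ofReal_le_ofReal ?_
    have hpx : 0 ≤ p x := by linarith [hp.one_lt, hp.lower x hx]
    exact (Real.rpow_le_rpow (norm_nonneg _) ((hD x).trans (le_max_left _ _)) hpx).trans
      (rpow_le_one_add_rpow (le_max_right _ _) hpx (hp.upper x hx))
  refine h.trans_lt ?_
  rw [lintegral_const, Measure.restrict_apply_univ]
  exact ENNReal.mul_lt_top ENNReal.ofReal_lt_top hΩ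

theorem exists_subseq_tendsto_ae_of_lintegral {f : ℕ → EuclideanSpace ℝ (Fin N) → F}
    {g : EuclideanSpace ℝ (Fin N) → F}
    (hf : ∀ n, AEStronglyMeasurable (f n) (volume.restrict Ω))
    (hg : AEStronglyMeasurable g (volume.restrict Ω))
    (h : Tendsto (fun n => ∫⁻ x in Ω, ‖f n x - g x‖ₑ) atTop (𝓝 0)) :
    ∃ ns : ℕ → ℕ, StrictMono ns ∧
      ∀ᵐ x ∂volume.restrict Ω, Tendsto (fun i => f (ns i) x) atTop (𝓝 (g x)) := by
  refine (tendstoInMeasure_of_tendsto_eLpNorm one_ne_zero hf hg ?_).exists_seq_tendsto_ae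
  simpa only [eLpNorm_one_eq_lintegral_enorm, Pi.sub_apply] using h

/-- A sequence that is Cauchy for the modular and converges in `L¹` converges for the modular. -/
theorem exists_modular_sub_le_of_cauchy (hp : BoundedExponent Ω p a b)
    {f : ℕ → EuclideanSpace ℝ (Fin N) → F} {g : EuclideanSpace ℝ (Fin N) → F}
    (hf : ∀ n, AEStronglyMeasurable (f n) (volume.restrict Ω))
    (hg : AEStronglyMeasurable g (volume.restrict Ω))
    (h : Tendsto (fun n => ∫⁻ x in Ω, ‖f n x - g x‖ₑ) atTop (𝓝 0))
    (hcau : ∀ ε : ℝ, 0 < ε → ∃ K, ∀ n ≥ K, ∀ k ≥ K,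
      modular Ω p (fun x => f n x - f k x) ≤ ENNReal.ofReal ε) {ε : ℝ} (hε : 0 < ε) :
    ∃ K, ∀ n ≥ K, modular Ω p (fun x => g x - f n x) ≤ ENNReal.ofReal ε := by
  obtain ⟨ns, hns, hae⟩ := exists_subseq_tendsto_ae_of_lintegral hf hg h
  obtain ⟨K, hK⟩ := hcau ε hε
  -- Fatou with `n` fixed and the other index running along an almost everywhere convergent
  -- subsequence.
  refine ⟨K, fun n hn => modular_le_of_tendsto_ae hp (f := fun i x => f (ns i) x - f n x)
    (fun i => (hf _).sub (hf n)) ?_ ?_⟩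
  · filter_upwards [hae] with x hx
    exact hx.sub_const _
  · filter_upwards [eventually_ge_atTop K] with i hi
    exact hK _ (hi.trans (hns.id_le i)) n hn

/-- Completeness of `L¹(Ω)` in terms of integrals. -/
theorem exists_tendsto_lintegral_of_cauchy [CompleteSpace F]
    {f : ℕ → EuclideanSpace ℝ (Fin N) → F} (hf : ∀ n, Integrable (f n) (volume.restrict Ω))
    (hcau : ∀ ε : ℝ, 0 < ε → ∃ K, ∀ n ≥ K, ∀ k ≥ K,
      ∫⁻ x in Ω, ‖f n x - f k x‖ₑ ≤ ENNReal.ofReal ε) :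
    ∃ g, Integrable g (volume.restrict Ω) ∧
      Tendsto (fun n => ∫⁻ x in Ω, ‖f n x - g x‖ₑ) atTop (𝓝 0) := by
  have hC : CauchySeq fun n => (hf n).toL1 := by
    rw [EMetric.cauchySeq_iff]
    intro ε hε
    obtain ⟨δ, hδ, hδε⟩ := ENNReal.lt_iff_exists_nnreal_btwn.1 hε
    obtain ⟨K, hK⟩ := hcau δ (by exact_mod_cast hδ)
    refine ⟨K, fun n hn k hk => ?_⟩
    rw [Integrable.edist_toL1_toL1]
    simp_rw [edist_eq_enorm_sub]
    refine (hK n hn k hk).trans_lt ?_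
    rwa [ENNReal.ofReal_coe_nnreal]
  obtain ⟨g, hg⟩ := cauchySeq_tendsto_of_complete hC
  refine ⟨g, L1.integrable_coeFn g, ?_⟩
  rw [tendsto_iff_edist_tendsto_0] at hg
  refine hg.congr fun n => ?_
  rw [← Integrable.toL1_coeFn g (L1.integrable_coeFn g), Integrable.edist_toL1_toL1]
  simp_rw [edist_eq_enorm_sub]
  refine lintegral_congr_ae ?_
  filter_upwards [(L1.integrable_coeFn g).coeFn_toL1] with x hx
  rw [Integrable.toL1_coeFn]

end Convergence

/-! ### Near-minimising sequences -/

/-- The infima over the shrinking sets increase and stay below `1`, so from some `K` on they vary by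
at most `δ / 2`. The value `i` is the infimum over `A K`: it bounds every competitor in `A K` from
below, midpoints included, and all later near-minimisers from above up to `δ`. -/
theorem exists_near_minimizing_seq {T : Type*} {A : ℕ → Set T} (hA : Antitone A) {Φ : T → ℝ≥0∞}
    (hΦ : ∀ n, ∀ δ : ℝ, 0 < δ → ∃ t ∈ A n, Φ t ≤ 1 + ENNReal.ofReal δ) :
    ∃ t : ℕ → T, (∀ n, t n ∈ A n) ∧ ∀ δ : ℝ, 0 < δ → ∃ K, ∃ i : ℝ, 0 ≤ i ∧ i ≤ 1 ∧
      (∀ n ≥ K, Φ (t n) ≤ ENNReal.ofReal (i + δ)) ∧ ∀ s ∈ A K, ENNReal.ofReal i ≤ Φ s := by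
  let I : ℕ → ℝ≥0∞ := fun n => ⨅ t ∈ A n, Φ t
  have hI1 : ∀ n, I n ≤ 1 := fun n => by
    refine ENNReal.le_of_forall_pos_le_add fun ε hε _ => ?_
    obtain ⟨t, ht, htΦ⟩ := hΦ n ε (by exact_mod_cast hε)
    rw [ENNReal.ofReal_coe_nnreal] at htΦ
    exact (iInf₂_le t ht).trans htΦ
  have hItop : ∀ n, I n ≠ ⊤ := fun n => ((hI1 n).trans_lt ENNReal.one_lt_top).ne
  have hImono : Monotone I := fun m n hmn => biInf_mono fun t ht => hA hmn ht
  have hS1 : ⨆ n, I n ≤ 1 := iSup_le hI1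
  have hchoose : ∀ n : ℕ, ∃ t ∈ A n, Φ t < I n + ENNReal.ofReal (1 / (n + 1)) := fun n => by
    have h : I n < I n + ENNReal.ofReal (1 / (n + 1)) :=
      ENNReal.lt_add_right (hItop n) (ENNReal.ofReal_pos.2 (by positivity)).ne'
    simpa only [I, iInf_lt_iff, exists_prop] using h
  choose t ht htΦ using hchoose
  refine ⟨t, ht, fun δ hδ => ?_⟩
  obtain ⟨K₁, hK₁⟩ := exists_nat_one_div_lt (half_pos hδ)
  obtain ⟨K₂, hK₂⟩ : ∃ K₂, ⨆ n, I n ≤ I K₂ + ENNReal.ofReal (δ / 2) := by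
    by_contra! h
    have h' : ∀ n, I n + ENNReal.ofReal (δ / 2) ≤ ⨆ n, I n := fun n => (h n).le
    have h2 : (⨆ n, I n) + ENNReal.ofReal (δ / 2) ≤ ⨆ n, I n := by
      rw [ENNReal.iSup_add]
      exact iSup_le h'
    exact absurd h2 (not_le.2 (ENNReal.lt_add_right (hS1.trans_lt ENNReal.one_lt_top).ne
      (ENNReal.ofReal_pos.2 (half_pos hδ)).ne'))
  set K := max K₁ K₂
  have hIK : ENNReal.ofReal (I K).toReal = I K := ENNReal.ofReal_toReal (hItop K)
  refine ⟨K, (I K).toReal, ENNReal.toReal_nonneg, ?_, fun n hn => ?_, fun s hs => ?_⟩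
  · exact ENNReal.toReal_le_of_le_ofReal zero_le_one (by simpa using hI1 K)
  · have hn' : (1 : ℝ) / (n + 1) ≤ δ / 2 := by
      refine le_trans ?_ hK₁.le
      have : (K₁ : ℝ) ≤ n := by exact_mod_cast (le_max_left K₁ K₂).trans hn
      gcongr
    calc Φ (t n) ≤ I n + ENNReal.ofReal (1 / (n + 1)) := (htΦ n).le
      _ ≤ (I K + ENNReal.ofReal (δ / 2)) + ENNReal.ofReal (δ / 2) := by
        refine add_le_add ((le_iSup I n).trans (hK₂.trans ?_)) (ENNReal.ofReal_le_ofReal hn')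
        gcongr
        exact hImono (le_max_right K₁ K₂)
      _ = ENNReal.ofReal ((I K).toReal + δ) := by
        rw [add_assoc, ← ENNReal.ofReal_add (by positivity) (by positivity), add_halves,
          ENNReal.ofReal_add ENNReal.toReal_nonneg hδ.le, hIK]
  · rw [hIK]
    exact iInf₂_le s hs

/-- From test functions that approximate `u` in `L¹` and have almost admissible gradients, one can
extract a sequence whose gradients are Cauchy for the modular. -/
theorem exists_modular_cauchy_seq (hp : BoundedExponent Ω p a b) {u : EuclideanSpace ℝ (Fin N) → ℝ}
    (hu : AEStronglyMeasurable u (volume.restrict Ω)) {c : ℝ}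
    (h : ∀ δ : ℝ, 0 < δ → ∃ φ, IsTestFunction Ω φ ∧ ∫⁻ x in Ω, ‖φ x - u x‖ₑ ≤ ENNReal.ofReal δ ∧
      modular Ω p (fun x => c • gradient φ x) ≤ 1 + ENNReal.ofReal δ) :
    ∃ φ : ℕ → EuclideanSpace ℝ (Fin N) → ℝ, (∀ n, IsTestFunction Ω (φ n)) ∧
      Tendsto (fun n => ∫⁻ x in Ω, ‖φ n x - u x‖ₑ) atTop (𝓝 0) ∧
      (∀ δ : ℝ, 0 < δ → ∀ᶠ n in atTop,
        modular Ω p (fun x => c • gradient (φ n) x) ≤ 1 + ENNReal.ofReal δ) ∧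
      ∀ ε : ℝ, 0 < ε → ∃ K, ∀ n ≥ K, ∀ k ≥ K,
        modular Ω p (fun x => c • gradient (φ n) x - c • gradient (φ k) x) ≤ ENNReal.ofReal ε := by
  let A : ℕ → Set (EuclideanSpace ℝ (Fin N) → ℝ) := fun n =>
    {φ | IsTestFunction Ω φ ∧ ∫⁻ x in Ω, ‖φ x - u x‖ₑ ≤ ENNReal.ofReal (1 / (n + 1))}
  have hA : Antitone A := by
    rintro m n hmn φ ⟨hφ, hφu⟩
    refine ⟨hφ, hφu.trans (ENNReal.ofReal_le_ofReal ?_)⟩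
    have : (m : ℝ) ≤ n := by exact_mod_cast hmn
    gcongr
  have hmid : ∀ K, ∀ φ ∈ A K, ∀ ψ ∈ A K, (fun x => (1 / 2 : ℝ) * (φ x + ψ x)) ∈ A K := by
    rintro K φ ⟨hφ, hφu⟩ ψ ⟨hψ, hψu⟩
    refine ⟨(hφ.add hψ).const_mul _, ?_⟩
    calc ∫⁻ x in Ω, ‖(1 / 2 : ℝ) * (φ x + ψ x) - u x‖ₑ
        ≤ ∫⁻ x in Ω, ENNReal.ofReal (1 / 2) * (‖φ x - u x‖ₑ + ‖ψ x - u x‖ₑ) := by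
          refine lintegral_mono fun x => ?_
          rw [show (1 / 2 : ℝ) * (φ x + ψ x) - u x = (1 / 2 : ℝ) * ((φ x - u x) + (ψ x - u x)) by
            ring, enorm_mul, Real.enorm_of_nonneg (by norm_num)]
          gcongr
          exact enorm_add_le _ _
      _ = ENNReal.ofReal (1 / 2) * ((∫⁻ x in Ω, ‖φ x - u x‖ₑ) + ∫⁻ x in Ω, ‖ψ x - u x‖ₑ) := by
          rw [lintegral_const_mul' _ _ ENNReal.ofReal_ne_top, lintegral_add_left']
          exact (hφ.1.continuous.aestronglyMeasurable.sub hu).enorm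
      _ ≤ ENNReal.ofReal (1 / 2) *
            (ENNReal.ofReal (1 / (K + 1)) + ENNReal.ofReal (1 / (K + 1))) := by gcongr
      _ = ENNReal.ofReal (1 / (K + 1)) := by
          rw [← ENNReal.ofReal_add (by positivity) (by positivity),
            ← ENNReal.ofReal_mul (by norm_num)]
          congr 1
          ring
  obtain ⟨φ, hφA, hφ⟩ := exists_near_minimizing_seq hA
    (Φ := fun φ => modular Ω p (fun x => c • gradient φ x)) (fun n δ hδ => by
      obtain ⟨φ, h1, h2, h3⟩ := h (min δ (1 / (n + 1))) (lt_min hδ (by positivity))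
      refine ⟨φ, ⟨h1, h2.trans (ENNReal.ofReal_le_ofReal (min_le_right _ _))⟩, h3.trans ?_⟩
      gcongr
      exact min_le_left _ _)
  refine ⟨φ, fun n => (hφA n).1, ?_, fun δ hδ => ?_, fun ε hε => ?_⟩
  · refine tendsto_of_tendsto_of_tendsto_of_le_of_le tendsto_const_nhds ?_ (fun _ => zero_le)
      fun n => (hφA n).2
    simpa using ENNReal.tendsto_ofReal tendsto_one_div_add_atTop_nhds_zero_nat
  · obtain ⟨K, i, hi0, hi1, hK, -⟩ := hφ δ hδ
    filter_upwards [eventually_ge_atTop K] with n hn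
    refine (hK n hn).trans ?_
    rw [← ENNReal.ofReal_one, ← ENNReal.ofReal_add zero_le_one hδ.le]
    exact ENNReal.ofReal_le_ofReal (by linarith)
  · obtain ⟨C, hC, hUC⟩ := exists_modular_uniform_convexity (F := EuclideanSpace ℝ (Fin N)) hp
      (by positivity : 0 < ε / 4)
    -- Uniform convexity will bound the modular of the difference plus `C * i` by `(ε / 2 + C) * (i
    -- + δ)`. After cancelling `C * i`, what remains is at most `ε / 2 + (ε / 2 + C) * δ`, as `i ≤
    -- 1`.
    obtain ⟨δ, hδ, hδε⟩ : ∃ δ : ℝ, 0 < δ ∧ (ε / 2 + C) * δ ≤ ε / 2 :=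
      ⟨(ε / 2) / (ε / 2 + C), by positivity, (mul_div_cancel₀ _ (by positivity)).le⟩
    obtain ⟨K, i, hi0, hi1, hK, hKi⟩ := hφ δ hδ
    refine ⟨K, fun n hn k hk => ?_⟩
    have hn' := hA hn (hφA n)
    have hk' := hA hk (hφA k)
    have key := hUC (fun x => c • gradient (φ n) x) (fun x => c • gradient (φ k) x)
      (hn'.1.continuous_gradient.const_smul c).aestronglyMeasurable
      (hk'.1.continuous_gradient.const_smul c).aestronglyMeasurable
    have hlow := hKi _ (hmid K _ hn' _ hk')
    have e : ∀ x, c • gradient (fun x => (1 / 2 : ℝ) * (φ n x + φ k x)) x =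
        (1 / 2 : ℝ) • (c • gradient (φ n) x + c • gradient (φ k) x) := fun x => by
      rw [(hn'.1.add hk'.1).gradient_const_mul, hn'.1.gradient_add hk'.1, ← smul_add, smul_comm]
    simp only [e] at hlow
    refine ENNReal.le_of_add_le_add_right (a := ENNReal.ofReal C * ENNReal.ofReal i)
      (ENNReal.mul_ne_top ENNReal.ofReal_ne_top ENNReal.ofReal_ne_top) ?_
    calc _ ≤ _ := by gcongr
      _ ≤ _ := key
      _ ≤ ENNReal.ofReal (ε / 4 + C / 2) * (ENNReal.ofReal (i + δ) + ENNReal.ofReal (i + δ)) := by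
        gcongr
        · exact hK n hn
        · exact hK k hk
      _ = ENNReal.ofReal ((ε / 2 + C) * (i + δ)) := by
        rw [← ENNReal.ofReal_add (by positivity) (by positivity),
          ← ENNReal.ofReal_mul (by positivity)]
        congr 1
        ring
      _ ≤ ENNReal.ofReal ε + ENNReal.ofReal C * ENNReal.ofReal i := by
        rw [← ENNReal.ofReal_mul hC, ← ENNReal.ofReal_add hε.le (by positivity)]
        refine ENNReal.ofReal_le_ofReal ?_
        nlinarith

/-! ### The closure of the test functions -/

/-- Test functions whose gradients are Cauchy for the modular are themselves Cauchy. -/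
theorem modular_cauchy_of_gradient (hΩ : Bornology.IsBounded Ω) (hN : 2 ≤ N)
    (hp : BoundedExponent Ω p a b) (hb : b < N) (hcont : ContinuousOn p (closure Ω))
    {φ : ℕ → EuclideanSpace ℝ (Fin N) → ℝ} (hφ : ∀ n, IsTestFunction Ω (φ n))
    (hcau : ∀ ε : ℝ, 0 < ε → ∃ K, ∀ n ≥ K, ∀ k ≥ K,
      modular Ω p (fun x => gradient (φ n) x - gradient (φ k) x) ≤ ENNReal.ofReal ε) {ε : ℝ}
    (hε : 0 < ε) : ∃ K, ∀ n ≥ K, ∀ k ≥ K,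
      modular Ω p (fun x => φ n x - φ k x) ≤ ENNReal.ofReal ε := by
  obtain ⟨C, hC, hP⟩ := exists_bound_modular_of_gradient hΩ hN hp hb hcont
  have ht0 : 0 < min 1 (ε / (C.toReal + 1)) := lt_min one_pos (by positivity)
  set t := min 1 (ε / (C.toReal + 1)) with ht
  have ht1 : t ≤ 1 := min_le_left _ _
  obtain ⟨K, hK⟩ := hcau (t ^ b) (by positivity)
  refine ⟨K, fun n hn k hk => ?_⟩
  -- Dividing the difference by `t` brings the gradient modular up to at most `1`, where the
  -- Poincaré bound applies; scaling back gains a factor `t`, and `t * C ≤ ε`.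
  have htest := ((hφ n).sub (hφ k)).const_mul t⁻¹
  have h1 := hP _ htest (by
    have e : gradient (fun x => t⁻¹ * (φ n x - φ k x)) =
        fun x => t⁻¹ • (gradient (φ n) x - gradient (φ k) x) := by
      funext x
      rw [((hφ n).sub (hφ k)).gradient_const_mul, (hφ n).gradient_sub (hφ k)]
    rw [e]
    refine (modular_smul_le_of_one_le hp ((one_le_inv₀ ht0).2 ht1) _).trans ?_
    calc _ ≤ ENNReal.ofReal (t⁻¹ ^ b) * ENNReal.ofReal (t ^ b) := by
          gcongr
          exact hK n hn k hk
      _ = 1 := by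
        rw [← ENNReal.ofReal_mul (by positivity), ← Real.mul_rpow (by positivity) ht0.le,
          inv_mul_cancel₀ ht0.ne', Real.one_rpow, ENNReal.ofReal_one])
  have h2 := modular_smul_le_of_le_one hp ht0 ht1 (fun x => t⁻¹ * (φ n x - φ k x))
  simp only [smul_eq_mul, mul_inv_cancel_left₀ ht0.ne'] at h2
  calc _ ≤ _ := h2
    _ ≤ ENNReal.ofReal t * C := by gcongr
    _ = ENNReal.ofReal (t * C.toReal) := by
      rw [ENNReal.ofReal_mul ht0.le, ENNReal.ofReal_toReal hC.ne]
    _ ≤ ENNReal.ofReal ε := by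
      refine ENNReal.ofReal_le_ofReal ?_
      have : t * (C.toReal + 1) ≤ ε := by
        rw [← le_div_iff₀ (by positivity)]
        exact min_le_right _ _
      nlinarith

/-- The closedness statement behind the theorem: only `L¹` approximation of `u` and an asymptotic
gradient bound are assumed, while strong approximation in `W^{1,p(x)}` results from replacing the
given test functions by near-minimisers. -/
theorem memW10_and_luxNorm_le (hΩo : IsOpen Ω) (hΩ : Bornology.IsBounded Ω) (hN : 2 ≤ N)
    (hp : BoundedExponent Ω p a b) (hb : b < N) (hcont : ContinuousOn p (closure Ω))
    {u : EuclideanSpace ℝ (Fin N) → ℝ} (hu : Integrable u (volume.restrict Ω)) {m : ℝ} (hm : 0 < m)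
    (h : ∀ δ : ℝ, 0 < δ → ∃ φ, IsTestFunction Ω φ ∧ ∫⁻ x in Ω, ‖φ x - u x‖ₑ ≤ ENNReal.ofReal δ ∧
      modular Ω p (fun x => m⁻¹ • gradient φ x) ≤ 1 + ENNReal.ofReal δ) :
    MemW10 Ω p u ∧ luxNorm Ω p (weakGradient Ω u) ≤ ENNReal.ofReal m := by
  have hv : volume Ω < ⊤ := hΩ.measure_lt_top
  obtain ⟨φ, hφ, hφu, hbound, hcau⟩ := exists_modular_cauchy_seq hp hu.aestronglyMeasurable h
  have hgm : ∀ n, AEStronglyMeasurable (gradient (φ n)) (volume.restrict Ω) := fun n =>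
    (hφ n).continuous_gradient.aestronglyMeasurable
  have hφm : ∀ n, AEStronglyMeasurable (φ n) (volume.restrict Ω) := fun n =>
    (hφ n).1.continuous.aestronglyMeasurable
  have hgcau : ∀ ε : ℝ, 0 < ε → ∃ K, ∀ n ≥ K, ∀ k ≥ K,
      modular Ω p (fun x => gradient (φ n) x - gradient (φ k) x) ≤ ENNReal.ofReal ε := by
    intro ε hε
    -- Undoing the factor `m⁻¹` is done with `max m 1`, since the estimate by `c ^ b` needs `c ≥ 1`.
    have hM1 : 1 ≤ max m 1 := le_max_right _ _
    have hMb : 0 < max m 1 ^ b := by positivity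
    obtain ⟨K, hK⟩ := hcau (ε / max m 1 ^ b) (by positivity)
    refine ⟨K, fun n hn k hk => ?_⟩
    calc modular Ω p (fun x => gradient (φ n) x - gradient (φ k) x)
        ≤ modular Ω p (fun x => max m 1 •
            (m⁻¹ • gradient (φ n) x - m⁻¹ • gradient (φ k) x)) := by
          refine modular_mono_norm hp fun x _ => ?_
          rw [← smul_sub, smul_smul, norm_smul, Real.norm_of_nonneg (by positivity)]
          refine le_mul_of_one_le_left (norm_nonneg _) ?_
          rw [← div_eq_mul_inv, one_le_div hm]
          exact le_max_left _ _
      _ ≤ _ := modular_smul_le_of_one_le hp hM1 _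
      _ ≤ ENNReal.ofReal (max m 1 ^ b) * ENNReal.ofReal (ε / max m 1 ^ b) := by
          gcongr
          exact hK n hn k hk
      _ = ENNReal.ofReal ε := by
          rw [← ENNReal.ofReal_mul hMb.le, mul_div_cancel₀ _ hMb.ne']
  obtain ⟨G, hG, hφG⟩ := exists_tendsto_lintegral_of_cauchy (Ω := Ω) (f := fun n => gradient (φ n))
    (fun n => by
      refine (Continuous.integrable_of_hasCompactSupport (hφ n).continuous_gradient ?_).restrict
      exact ((hφ n).2.1.fderiv ℝ).comp_left (map_zero _))
    (fun ε hε => by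
      obtain ⟨δ, hδ, hδε⟩ := exists_lintegral_enorm_le_of_modular_le
        (F := EuclideanSpace ℝ (Fin N)) hp hv hε
      obtain ⟨K, hK⟩ := hgcau δ hδ
      exact ⟨K, fun n hn k hk => hδε _ (hK n hn k hk)⟩)
  have hweak : HasWeakGradient Ω u G := hasWeakGradient_of_tendsto hφ hu hG hφu hφG
  have hae := weakGradient_ae_eq hΩo hweak
  have hG1 : modular Ω p (fun x => m⁻¹ • G x) ≤ 1 := by
    obtain ⟨ns, hns, hlim⟩ :=
      exists_subseq_tendsto_ae_of_lintegral hgm hG.aestronglyMeasurable hφG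
    refine ENNReal.le_of_forall_pos_le_add fun ε hε _ => ?_
    rw [← ENNReal.ofReal_coe_nnreal]
    refine modular_le_of_tendsto_ae hp (f := fun i x => m⁻¹ • gradient (φ (ns i)) x)
      (fun i => (hgm _).const_smul m⁻¹) ?_
      (hns.tendsto_atTop.eventually (hbound ε (by exact_mod_cast hε)))
    filter_upwards [hlim] with x hx
    exact hx.const_smul _
  have hw1 : modular Ω p (fun x => m⁻¹ • weakGradient Ω u x) ≤ 1 := by
    rwa [modular_congr_ae (g := fun x => m⁻¹ • G x)]
    filter_upwards [hae] with x hx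
    rw [hx]
  have happrox : ∀ ε : ℝ, 0 < ε → ∃ K, ∀ n ≥ K,
      modular Ω p (fun x => u x - φ n x) ≤ ENNReal.ofReal ε := fun ε hε =>
    exists_modular_sub_le_of_cauchy hp hφm hu.aestronglyMeasurable hφu
      (fun ε hε => modular_cauchy_of_gradient hΩ hN hp hb hcont hφ hgcau hε) hε
  have happrox' : ∀ ε : ℝ, 0 < ε → ∃ K, ∀ n ≥ K,
      modular Ω p (fun x => weakGradient Ω u x - gradient (φ n) x) ≤ ENNReal.ofReal ε := by
    intro ε hε
    obtain ⟨K, hK⟩ :=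
      exists_modular_sub_le_of_cauchy hp hgm hG.aestronglyMeasurable hφG hgcau hε
    refine ⟨K, fun n hn => ?_⟩
    rw [modular_congr_ae (g := fun x => G x - gradient (φ n) x)]
    · exact hK n hn
    · filter_upwards [hae] with x hx
      rw [hx]
  refine ⟨⟨⟨⟨hu.aestronglyMeasurable, ?_⟩, ⟨G, hweak⟩, ?_, ?_⟩, fun ε hε => ?_⟩,
    luxNorm_le_of_modular_le hm hw1⟩
  · obtain ⟨K, hK⟩ := happrox 1 one_pos
    obtain ⟨D, hD⟩ := (hφ K).2.1.exists_bound_of_continuous (hφ K).1.continuous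
    have h1 := modular_add_le hp (g := fun x => u x - φ K x) (hφm K)
    simp only [add_sub_cancel] at h1
    refine h1.trans_lt (ENNReal.mul_lt_top ENNReal.ofReal_lt_top (ENNReal.add_lt_top.2
      ⟨modular_lt_top_of_bounded hp hv hD, (hK K le_rfl).trans_lt ENNReal.ofReal_lt_top⟩))
  · exact hG.aestronglyMeasurable.congr hae.symm
  · have h1 := modular_smul_lt_top hp m (hw1.trans_lt ENNReal.one_lt_top)
    simpa only [smul_smul, mul_inv_cancel₀ hm.ne', one_smul] using h1
  · obtain ⟨δ, hδ, hδε⟩ := ENNReal.lt_iff_exists_nnreal_btwn.1 hε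
    have hδ' : 0 < (δ : ℝ) := by exact_mod_cast hδ
    have hr0 : 0 < min 1 ((δ : ℝ) / 2) := lt_min one_pos (by positivity)
    set r := min 1 ((δ : ℝ) / 2)
    have hr1 : r ≤ 1 := min_le_left _ _
    obtain ⟨K, hK⟩ := happrox (r ^ b) (by positivity)
    obtain ⟨K', hK'⟩ := happrox' (r ^ b) (by positivity)
    refine ⟨φ (max K K'), hφ _, lt_of_le_of_lt (add_le_add
      (luxNorm_le_of_modular_le_rpow hp hr0 hr1 (hK _ (le_max_left _ _)))
      (luxNorm_le_of_modular_le_rpow hp hr0 hr1 (hK' _ (le_max_right _ _)))) ?_⟩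
    rw [← ENNReal.ofReal_add hr0.le hr0.le]
    refine lt_of_le_of_lt (ENNReal.ofReal_le_ofReal ?_)
      (by rwa [ENNReal.ofReal_coe_nnreal] : ENNReal.ofReal δ < ε)
    linarith [min_le_right 1 ((δ : ℝ) / 2)]

/-! ### Approximation by test functions below the `Γ`-lower limit -/

theorem exists_lt_of_gammaLiminf_lt {X : Type*} [TopologicalSpace X] {f : ℕ → X → ℝ≥0∞} {u : X}
    {c : ℝ≥0∞} (h : gammaLiminf f u < c) {U : Set X} (hU : IsOpen U) (hu : u ∈ U) :
    ∃ᶠ n in atTop, ∃ v ∈ U, f n v < c := by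
  have h1 : liminf (fun n => ⨅ v ∈ U, f n v) atTop < c :=
    ((le_iSup (fun _ : u ∈ U => liminf (fun n => ⨅ v ∈ U, f n v) atTop) hu).trans
      (le_iSup₂ (f := fun (U : Set X) (_ : IsOpen U) =>
        ⨆ _ : u ∈ U, liminf (fun n => ⨅ v ∈ U, f n v) atTop) U hU)).trans_lt h
  refine (frequently_lt_of_liminf_lt (by isBoundedDefault) h1).mono fun n hn => ?_
  simpa only [iInf_lt_iff, exists_prop] using hn

/-- A function of finite energy is approximated in `L¹` by test functions with controlled
gradient. -/
theorem exists_testFunction_of_energy_lt {v : Lp ℝ 1 (volume.restrict Ω)}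
    (hp : BoundedExponent Ω p a b) (hv : volume Ω < ⊤) {c : ℝ≥0∞} (h : energy Ω p v < c) {δ : ℝ}
    (hδ : 0 < δ) : ∃ φ, IsTestFunction Ω φ ∧ ∫⁻ x in Ω, ‖φ x - v x‖ₑ ≤ ENNReal.ofReal δ ∧
      luxNorm Ω p (gradient φ) < c := by
  unfold energy at h
  split_ifs at h with hmem
  swap
  · exact absurd h not_top_lt
  obtain ⟨δ', hδ', hδ'δ⟩ := exists_lintegral_enorm_le_of_modular_le (F := ℝ) hp hv hδ
  set r := min 1 δ'
  have hr0 : 0 < r := lt_min one_pos hδ'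
  -- The first tolerance forces `L¹` closeness; the second is the room left below `c`, so the
  -- triangle inequality keeps the gradient norm of `φ` under `c`.
  obtain ⟨φ, hφ, hlt⟩ := hmem.2 (min (ENNReal.ofReal r) (c - luxNorm Ω p (weakGradient Ω v)))
    (lt_min (ENNReal.ofReal_pos.2 hr0) (tsub_pos_of_lt h))
  refine ⟨φ, hφ, ?_, ?_⟩
  · have h1 := modular_le_of_luxNorm_lt hp hr0 (min_le_left _ _)
      ((le_self_add.trans_lt hlt).trans_le (min_le_left _ _))
    have h2 := hδ'δ _ (h1.trans (ENNReal.ofReal_le_ofReal (min_le_right _ _)))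
    simpa only [enorm_sub_rev] using h2
  · have h1 := luxNorm_add_le hp (g := fun x => gradient φ x - weakGradient Ω v x) hmem.1.2.2.1
    simp only [add_sub_cancel] at h1
    have h2 : luxNorm Ω p (fun x => gradient φ x - weakGradient Ω v x) =
        luxNorm Ω p (fun x => weakGradient Ω v x - gradient φ x) := by
      simp only [luxNorm, modular, norm_smul, norm_sub_rev]
    rw [h2] at h1
    refine h1.trans_lt (lt_tsub_iff_left.1 ?_)
    exact (le_add_self.trans_lt hlt).trans_le (min_le_right _ _)

end VarExp

/-! ### The `Γ`-lower limit inequality -/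

theorem theorem2p6 {N : ℕ} (hN : 2 ≤ N) (Ω : Set (EuclideanSpace ℝ (Fin N)))
    (hΩ_open : IsOpen Ω) (hΩ_conn : IsConnected Ω) (hΩ_bdd : Bornology.IsBounded Ω)
    (hΩ_lip : VarExp.HasLipschitzBoundary Ω)
    (p : EuclideanSpace ℝ (Fin N) → ℝ) (hp : VarExp.IsAdmissible Ω p)
    (ph : ℕ → EuclideanSpace ℝ (Fin N) → ℝ) (hph : ∀ h, VarExp.IsAdmissible Ω (ph h))
    (hle : ∀ h, ∀ x ∈ Ω, p x ≤ ph h x)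
    (hunif : TendstoUniformlyOn ph p atTop Ω)
    (u : Lp ℝ 1 (volume.restrict Ω)) :
    VarExp.energy Ω p u ≤ VarExp.gammaLiminf (fun h => VarExp.energy Ω (ph h)) u := by
  obtain ⟨a, b, hb, hpb⟩ := hp.exists_boundedExponent hΩ_open
  have hv : volume Ω < ⊤ := hΩ_bdd.measure_lt_top
  refine le_of_forall_gt_imp_ge_of_dense fun c hc => ?_
  rcases eq_or_ne c ⊤ with rfl | hctop
  · exact le_top
  have hm : 0 < c.toReal := ENNReal.toReal_pos (pos_of_gt hc).ne' hctop
  have hcm : ENNReal.ofReal c.toReal = c := ENNReal.ofReal_toReal hctop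
  have key := VarExp.memW10_and_luxNorm_le hΩ_open hΩ_bdd hN hpb hb hp.continuousOn
    (u := u) (L1.integrable_coeFn u) hm (fun δ hδ => by
      have hV : 0 < (volume Ω).toReal + 1 := by positivity
      -- Uniform closeness of the exponents within `δ / (|Ω| + 1)` makes the cost of changing
      -- exponent at most `δ`.
      have hη : 0 < δ / ((volume Ω).toReal + 1) := by positivity
      have hfreq := VarExp.exists_lt_of_gammaLiminf_lt hc
        (Metric.isOpen_eball (x := u) (ε := ENNReal.ofReal (δ / 2)))
        (Metric.mem_eball_self (ENNReal.ofReal_pos.2 (half_pos hδ)))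
      -- The lower limit gives good `v` only for infinitely many `h`; uniform convergence holds for
      -- all large `h`, so one index serves both.
      obtain ⟨h, ⟨v, hvu, hvc⟩, hclose⟩ :=
        (hfreq.and_eventually (Metric.tendstoUniformlyOn_iff.1 hunif _ hη)).exists
      obtain ⟨a', b', -, hpb'⟩ := (hph h).exists_boundedExponent hΩ_open
      obtain ⟨φ, hφ, hφv, hφc⟩ :=
        VarExp.exists_testFunction_of_energy_lt hpb' hv hvc (half_pos hδ)
      refine ⟨φ, hφ, ?_, ?_⟩
      · calc ∫⁻ x in Ω, ‖φ x - u x‖ₑ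
            ≤ ∫⁻ x in Ω, (‖φ x - v x‖ₑ + ‖v x - u x‖ₑ) := by
              refine lintegral_mono fun x => ?_
              rw [← sub_add_sub_cancel (φ x) (v x) (u x)]
              exact enorm_add_le _ _
          _ = (∫⁻ x in Ω, ‖φ x - v x‖ₑ) + ∫⁻ x in Ω, ‖v x - u x‖ₑ := by
              refine lintegral_add_left' ?_ _
              exact (hφ.1.continuous.aestronglyMeasurable.sub
                (Lp.aestronglyMeasurable v)).enorm
          _ ≤ ENNReal.ofReal (δ / 2) + ENNReal.ofReal (δ / 2) := by
              gcongr
              have : edist v u < ENNReal.ofReal (δ / 2) := hvu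
              rw [Lp.edist_def, eLpNorm_one_eq_lintegral_enorm] at this
              exact this.le
          _ = ENNReal.ofReal δ := by
              rw [← ENNReal.ofReal_add (half_pos hδ).le (half_pos hδ).le, add_halves]
      · have h1 := VarExp.modular_inv_smul_le_one_of_luxNorm_lt hpb' (hφc.trans_eq hcm.symm)
        refine (VarExp.modular_le_modular_add hpb hη.le (hle h) (fun x hx => ?_) _).trans
          (add_le_add h1 ?_)
        · have := hclose x hx
          rw [Real.dist_eq, abs_sub_comm] at this
          linarith [(abs_lt.1 this).2]
        · rw [← ENNReal.toReal_le_toReal (ENNReal.mul_ne_top ENNReal.ofReal_ne_top hv.ne)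
            ENNReal.ofReal_ne_top, ENNReal.toReal_mul, ENNReal.toReal_ofReal hη.le,
            ENNReal.toReal_ofReal hδ.le, div_mul_eq_mul_div, div_le_iff₀ hV]
          nlinarith)
  rw [VarExp.energy, if_pos key.1]
  exact key.2.trans_eq hcm
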